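/- Let $\mathbb{P}$ be the set of primes and let $p_0<p_1<\cdots$ be its increasing enumeration. A supernatural number is a function $\epsilon:\mathbb{P}\to\mathbb{N}\cup\{\infty\}$. It is lower semicomputable if it is the pointwise limit of a uniformly computable sequence $(h_j)_{j\in\mathbb{N}}$ of functions $h_j:\mathbb{P}\to\mathbb{N}$ with $h_j(p)\le h_{j+1}(p)$ for all $j$ and $p$. Let $W_e\subseteq\mathbb{N}$ be the $e$-th computably enumerable set (the domain of the $e$-th partial computable function), and let $\epsilon$ be the supernatural number with $\epsilon(p_e)=|W_e|$ for all $e\in\mathbb{N}$, where $|W_e|=\infty$ if $W_e$ is infinite. A UHF algebra is a unital $\mathrm{C}^*$-algebra $\mathbf{A}\cong\varinjlim M_{n_k}(\mathbb{C})$ with unital connecting embeddings; its supernatural number is $\epsilon_{\mathbf{A}}(p)=\sup\{m\in\mathbb{N}: p^m \text{ divides } n_k\text{ for some }k\}$, which does not depend on the choice of the sequence of matrix algebras. A computable presentation of $\mathbf{A}$ is a sequence $(a_j)_{j\in\mathbb{N}}$ in $\mathbf{A}$ that generates a dense $*$-subalgebra and for which there is an algorithm that, given a $*$-polynomial $q$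 without constant term and with coefficients in $\mathbb{Q}(i)$ and given $k\in\mathbb{N}$, outputs a rational number $r$ with $\bigl|\,\|q(a_0,a_1,\ldots)\|-r\,\bigr|<2^{-k}$. Then $\epsilon$ is lower semicomputable, and the Turing degree of $\epsilon$ is $\mathbf{0}''$. Moreover, $\epsilon$ is not computable, and there is a UHF algebra that has a computable presentation and whose supernatural number is $\epsilon$. Hence a computably presentable UHF algebra need not have a computable supernatural number. -/

import Mathlib

open Filter Topology Encodable Denumerable

namespace UHFComp

/-! ### Oracle computability, the Turing jump and the degree `0''` -/

/-- Programs for partial functions `ℕ →. ℕ` that may query an oracle. -/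
inductive OracleCode : Type
  | zero : OracleCode
  | succ : OracleCode
  | left : OracleCode
  | right : OracleCode
  | oracle : OracleCode
  | pair : OracleCode → OracleCode → OracleCode
  | comp : OracleCode → OracleCode → OracleCode
  | prec : OracleCode → OracleCode → OracleCode
  | rfind' : OracleCode → OracleCode

namespace OracleCode

/-- The code number of an oracle program. -/
def encodeCode : OracleCode → ℕ
  | zero => 0
  | succ => 1
  | left => 2
  | right => 3
  | oracle => 4
  | pair cf cg => 2 * (2 * Nat.pair (encodeCode cf) (encodeCode cg)) + 5
  | comp cf cg => 2 * (2 * Nat.pair (encodeCode cf) (encodeCode cg) + 1) + 5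
  | prec cf cg => (2 * (2 * Nat.pair (encodeCode cf) (encodeCode cg)) + 1) + 5
  | rfind' cf => (2 * (2 * encodeCode cf + 1) + 1) + 5

/-- The oracle program with a given code number. -/
def ofNatCode : ℕ → OracleCode
  | 0 => zero
  | 1 => succ
  | 2 => left
  | 3 => right
  | 4 => oracle
  | n + 5 =>
    let m := n.div2.div2
    have hm : m < n + 5 := by
      simp only [m, Nat.div2_val]
      exact lt_of_le_of_lt (le_trans (Nat.div_le_self _ _) (Nat.div_le_self _ _))
        (Nat.succ_le_succ (Nat.le_add_right _ _))
    have _m1 : m.unpair.1 < n + 5 := lt_of_le_of_lt m.unpair_left_le hm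
    have _m2 : m.unpair.2 < n + 5 := lt_of_le_of_lt m.unpair_right_le hm
    match n.bodd, n.div2.bodd with
    | false, false => pair (ofNatCode m.unpair.1) (ofNatCode m.unpair.2)
    | false, true => comp (ofNatCode m.unpair.1) (ofNatCode m.unpair.2)
    | true, false => prec (ofNatCode m.unpair.1) (ofNatCode m.unpair.2)
    | true, true => rfind' (ofNatCode m)
decreasing_by all_goals first | exact hm | exact _m1 | exact _m2

theorem encode_ofNatCode : ∀ n, encodeCode (ofNatCode n) = n
  | 0 => by simp [ofNatCode, encodeCode]
  | 1 => by simp [ofNatCode, encodeCode]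
  | 2 => by simp [ofNatCode, encodeCode]
  | 3 => by simp [ofNatCode, encodeCode]
  | 4 => by simp [ofNatCode, encodeCode]
  | n + 5 => by
    let m := n.div2.div2
    have hm : m < n + 5 := by
      simp only [m, Nat.div2_val]
      exact lt_of_le_of_lt (le_trans (Nat.div_le_self _ _) (Nat.div_le_self _ _))
        (Nat.succ_le_succ (Nat.le_add_right _ _))
    have _m1 : m.unpair.1 < n + 5 := lt_of_le_of_lt m.unpair_left_le hm
    have _m2 : m.unpair.2 < n + 5 := lt_of_le_of_lt m.unpair_right_le hm
    have IH := encode_ofNatCode m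
    have IH1 := encode_ofNatCode m.unpair.1
    have IH2 := encode_ofNatCode m.unpair.2
    conv_rhs => rw [← Nat.bit_bodd_div2 n, ← Nat.bit_bodd_div2 n.div2]
    simp only [ofNatCode.eq_6]
    cases n.bodd <;> cases n.div2.bodd <;>
      simp [m, encodeCode, IH, IH1, IH2, Nat.bit_val]
decreasing_by all_goals first | exact hm | exact _m1 | exact _m2

/-- The bijective numbering of oracle programs. -/
instance instDenumerable : Denumerable OracleCode :=
  Denumerable.mk'
    ⟨encodeCode, ofNatCode, fun c => by
        induction c <;> simp [encodeCode, ofNatCode, Nat.div2_val, *],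
      encode_ofNatCode⟩

/-- The partial function computed by a program with oracle `O`. -/
def eval (O : ℕ →. ℕ) : OracleCode → ℕ →. ℕ
  | zero => pure 0
  | succ => Nat.succ
  | left => ↑fun n : ℕ => n.unpair.1
  | right => ↑fun n : ℕ => n.unpair.2
  | oracle => O
  | pair cf cg => fun n => Nat.pair <$> eval O cf n <*> eval O cg n
  | comp cf cg => fun n => eval O cg n >>= eval O cf
  | prec cf cg =>
    Nat.unpaired fun a n =>
      n.rec (eval O cf a) fun y IH => do
        let i ← IH
        eval O cg (Nat.pair a (Nat.pair y i))
  | rfind' cf =>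
    Nat.unpaired fun a m =>
      (Nat.rfind fun n => (fun m => m = 0) <$> eval O cf (Nat.pair a (n + m))).map (· + m)

end OracleCode

open Classical in
/-- The characteristic function of a set of natural numbers, as an oracle. -/
noncomputable def charFun (X : Set ℕ) : ℕ →. ℕ :=
  fun n => Part.some (if n ∈ X then 1 else 0)

/-- The Turing jump `X' = {e | φ_e^X(e) halts}`. -/
def jump (X : Set ℕ) : Set ℕ :=
  {e | (OracleCode.eval (charFun X) (ofNat OracleCode e) e).Dom}

/-- The Turing degree of a partial function on the natural numbers. -/
def natDegree (f : ℕ →. ℕ) : TuringDegree := toAntisymmetrization TuringReducible f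

/-- The Turing degree `0''`. -/
noncomputable def zeroDoubleJump : TuringDegree := natDegree (charFun (jump (jump ∅)))

/-- The total function on code numbers that represents `f`: the code of `a` is sent to (the code
of) `f a`, and a number that codes no element of `α` is sent to a default value. -/
def onCodes {α β : Type} [Primcodable α] [Primcodable β] (f : α → β) : ℕ → ℕ :=
  fun n => encode ((decode n : Option α).map f)

/-- The Turing degree of a function between effectively coded types. -/
def turingDegree {α β : Type} [Primcodable α] [Primcodable β] (f : α → β) : TuringDegree :=
  natDegree (onCodes f : ℕ →. ℕ)

/-- The `e`-th computably enumerable set, the domain of the `e`-th partial computable function. -/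
def W (e : ℕ) : Set ℕ := {n | (Nat.Partrec.Code.eval (ofNat Nat.Partrec.Code e) n).Dom}

/-! ### Supernatural numbers -/

theorem primrecPred_prime : PrimrecPred Nat.Prime := by
  have hdvd : PrimrecRel fun m n : ℕ => ¬ (m ∣ n) ∨ m = 1 :=
    PrimrecPred.or
      (PrimrecPred.not
        ((Primrec.eq.comp (Primrec.nat_mod.comp Primrec.snd Primrec.fst)
          (Primrec.const 0)).of_eq fun p => (Nat.dvd_iff_mod_eq_zero).symm))
      (Primrec.eq.comp Primrec.fst (Primrec.const 1))
  have hall : PrimrecPred fun n : ℕ => ∀ m < n, ¬ (m ∣ n) ∨ m = 1 :=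
    hdvd.forall_lt.comp Primrec.id Primrec.id
  refine (PrimrecPred.and (Primrec.nat_le.comp (Primrec.const 2) Primrec.id) hall).of_eq ?_
  intro n
  rw [Nat.prime_def_lt]
  refine and_congr Iff.rfl (forall_congr' fun m => forall_congr' fun _ => ?_)
  tauto

/-- A prime is coded by itself. -/
instance instPrimcodablePrimes : Primcodable Nat.Primes := Primcodable.subtype primrecPred_prime

/-- The identification of `ℕ ∪ {∞}` with `Option ℕ`, where `∞` is `none`. -/
def enatEquiv : ℕ∞ ≃ Option ℕ := Equiv.refl _

instance instPrimcodableENat : Primcodable ℕ∞ := Primcodable.ofEquiv (Option ℕ) enatEquiv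

/-- A supernatural number: a function from the primes to `ℕ ∪ {∞}`. -/
abbrev Supernatural : Type := Nat.Primes → ℕ∞

/-- The increasing enumeration `p_0 < p_1 < ...` of the primes. -/
noncomputable def nthPrime (e : ℕ) : Nat.Primes := ⟨Nat.nth Nat.Prime e, Nat.prime_nth_prime e⟩

/-- `ε` is the pointwise limit of a uniformly computable nondecreasing sequence of functions from
the primes to `ℕ`. -/
def LowerSemicomputable (ε : Supernatural) : Prop :=
  ∃ h : ℕ → Nat.Primes → ℕ, Computable₂ h ∧ (∀ j p, h j p ≤ h (j + 1) p) ∧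
    ∀ p, Tendsto (fun j => (h j p : ℕ∞)) atTop (𝓝 (ε p))

/-! ### UHF algebras -/

/-- A representation of `A` as the C⋆-algebraic inductive limit of matrix algebras `M_{n k}(ℂ)`
along unital ⋆-homomorphisms `conn k`, with canonical maps `incl k` into the limit. (The maps
`incl k` are injective, hence isometric, and `conn k` is injective because `incl k` is.) -/
structure UHFLimit (A : Type) [CStarAlgebra A] where
  n : ℕ → ℕ
  n_pos : ∀ k, 0 < n k
  conn : ∀ k, Matrix (Fin (n k)) (Fin (n k)) ℂ →⋆ₐ[ℂ] Matrix (Fin (n (k + 1))) (Fin (n (k + 1))) ℂ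
  incl : ∀ k, Matrix (Fin (n k)) (Fin (n k)) ℂ →⋆ₐ[ℂ] A
  incl_injective : ∀ k, Function.Injective (incl k)
  incl_conn : ∀ k x, incl (k + 1) (conn k x) = incl k x
  dense : Dense (⋃ k, Set.range (incl k))

/-- A unital C⋆-algebra is UHF if it is an inductive limit of matrix algebras with unital
connecting embeddings. -/
def IsUHF (A : Type) [CStarAlgebra A] : Prop := Nonempty (UHFLimit A)

/-- `ε(p) = sup {m | p ^ m divides n_k for some k}`. -/
noncomputable def UHFLimit.supernatural {A : Type} [CStarAlgebra A] (S : UHFLimit A) :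
    Supernatural :=
  fun p => ⨆ m ∈ {m : ℕ | ∃ k, (p : ℕ) ^ m ∣ S.n k}, (m : ℕ∞)

/-- `A` is a UHF algebra and `ε` is its supernatural number, whichever sequence of matrix algebras
is used to compute it. -/
def IsSupernaturalNumberOf (ε : Supernatural) (A : Type) [CStarAlgebra A] : Prop :=
  IsUHF A ∧ ∀ S : UHFLimit A, S.supernatural = ε

/-! ### Computable presentations of C⋆-algebras -/

/-- A ⋆-monomial without constant term and with coefficient in `ℚ(i)`: the triple `(a, b, d)`
stands for the coefficient `(a + b i) / (d + 1)`, and the letters `(j, false)` and `(j, true)` of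
the nonempty word (its first letter and the list of the others) stand for `x_j` and `x_j⋆`. -/
abbrev StarMonomial : Type := (ℤ × ℤ × ℕ) × (ℕ × Bool) × List (ℕ × Bool)

/-- A ⋆-polynomial without constant term and with coefficients in `ℚ(i)`: a list of monomials,
which stands for their sum. -/
abbrev StarPolynomial : Type := List StarMonomial

/-- The value of the coefficient `(a, b, d)`. -/
noncomputable def coeffVal (c : ℤ × ℤ × ℕ) : ℂ :=
  ((c.1 : ℂ) + (c.2.1 : ℂ) * Complex.I) / ((c.2.2 : ℂ) + 1)

section
variable {A : Type} [CStarAlgebra A]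

/-- The value of a letter at a sequence of points of `A`. -/
def letterVal (a : ℕ → A) (l : ℕ × Bool) : A := if l.2 then star (a l.1) else a l.1

/-- The value of a ⋆-monomial at a sequence of points of `A`. -/
noncomputable def monomialVal (a : ℕ → A) (m : StarMonomial) : A :=
  coeffVal m.1 • (letterVal a m.2.1 * (m.2.2.map (letterVal a)).prod)

/-- The rational point given by a ⋆-polynomial and the special points `a 0, a 1, ...`. -/
noncomputable def rationalPoint (a : ℕ → A) (q : StarPolynomial) : A :=
  (q.map (monomialVal a)).sum

/-- `a` is a presentation of `A`: the (not necessarily unital) ⋆-subalgebra that it generates is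
dense. -/
def IsPresentation (a : ℕ → A) : Prop :=
  Dense (NonUnitalStarAlgebra.adjoin ℂ (Set.range a) : Set A)

/-- A presentation is computable if an algorithm, given a rational point `q` and `k`, outputs a
rational number `r` with `|‖q‖ - r| < 2⁻ᵏ`; the output `(m, d)` stands for `m / (d + 1)`. -/
def IsComputablePresentation (a : ℕ → A) : Prop :=
  IsPresentation a ∧ ∃ r : StarPolynomial → ℕ → ℤ × ℕ, Computable₂ r ∧
    ∀ q k, |‖rationalPoint a q‖ - ((r q k).1 : ℝ) / (((r q k).2 : ℝ) + 1)| < (2 : ℝ)⁻¹ ^ k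

end

/-- `A` has a computable presentation. -/
def ComputablyPresentable (A : Type) [CStarAlgebra A] : Prop :=
  ∃ a : ℕ → A, IsComputablePresentation a

end UHFComp

/-! Take `cardSupernatural`, sending a prime `p` to `|W_e|`, where `e` is the number of primes below
`p`. Counting the elements enumerated by stage `j` gives the lower approximation `stageCard`.

Degree. The relation `k < |W_e|` is Σ₁, so `∅'` decides it. Finiteness of `W_e` is then a halting
search relative to `∅'`, so `∅''` decides it and afterwards finds the cardinality
(`cardCode_recursiveIn`). Conversely, `e ∈ ∅''` means that some finite string `σ` and stage `t`
satisfy: program `e` halts on `e` within `t` steps with oracle `σ`, and no later stage `s` refutes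
that `σ` is an initial segment of `∅'`. This is a form `∃ z, ∀ s, R` with `R` primitive recursive
(`exists_sigma_two_matrix`). The set of `m` such that every `z ≤ m` is refuted at some `s` is a c.e.
initial segment of `ℕ`, finite exactly when `e ∈ ∅''` (`exists_primrec_finite_W`). Noncomputability
is proved separately, by Rice's theorem applied to finiteness of the domain.

Invariance. Trace-zero matrices have distance at least 1 from the identity, so `1` is not in the
span of the commutators, and a UHF algebra carries a normalized tracial functional. A minimal
diagonal projection of a unital copy of `M_m` has trace `1/m`. It is close, hence similar, to an
idempotent of some `M_{n_k}`, whose trace is `r/n_k`. So `m` divides `n_k` (`UHFLimit.exists_dvd`),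
and any two sequences of sizes have the same supernatural number.

Existence. `M_n` acts on `ℓ²(ℕ)` through the last base-`n` digit. These actions are compatible when
sizes divide one another, so the algebra is the closure of an increasing union of operator algebras.
With sizes `∏_{p<k} p ^ stageApprox k p` the supernatural number is the required one
(`supernatural_cardSizes`). The presentation consists of all matrix units. After denominators are
cleared, a rational point is a matrix over the Gaussian integers. Its norm is squeezed between
traces of repeated star-squares, up to factors depending only on the size, and these disappear under
high roots. A search for integer inequalities therefore computes the norm
(`SizeSequence.computablyPresentable`). -/

namespace UHFComp

/-! ### Oracle programs: uniform translation to ordinary programs -/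

/-! ### Oracle programs: parametrization, use principle, s-m-n. -/

namespace OracleCode

open Nat.Partrec (Code)

/-- The program for `(σ, (a, z)) ↦ ((σ, a), z)`. -/
def assocCode : Code :=
  .pair (.pair .left (.comp .left .right)) (.comp .right .right)

/-- The program for `((σ, a), z) ↦ (σ, (a, z))`. -/
def unassocCode : Code :=
  .pair (.comp .left .left) (.pair (.comp .right .left) .right)

/-- Replace the oracle by the program `d`, which receives an additional parameter. -/
def translate (d : Code) : OracleCode → Code
  | zero => .zero
  | succ => .comp .succ .right
  | left => .comp .left .right
  | right => .comp .right .right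
  | oracle => d
  | pair f g => .pair (translate d f) (translate d g)
  | comp f g => .comp (translate d f) (.pair .left (translate d g))
  -- In this case and the next the input is a pair whose second entry is the recursion or search
  -- variable. The parameter is grouped with the first entry, which stays fixed, and is moved back
  -- before a subprogram is called.
  | prec f g => .comp (.prec (translate d f) (.comp (translate d g) unassocCode)) assocCode
  | rfind' f => .comp (.rfind' (.comp (translate d f) unassocCode)) assocCode

/-- The value of an ordinary program, as a function to `Part ℕ`. -/
def crun (c : Code) (x : ℕ) : Part ℕ := c.eval x

/-- The value of an oracle program, as a function to `Part ℕ`. -/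
def run (O : ℕ → Part ℕ) (c : OracleCode) (x : ℕ) : Part ℕ := eval O c x

theorem crun_left (x : ℕ) : crun .left x = Part.some x.unpair.1 := rfl

theorem crun_right (x : ℕ) : crun .right x = Part.some x.unpair.2 := rfl

theorem crun_comp (f g : Code) (x : ℕ) : crun (.comp f g) x = (crun g x).bind (crun f) := rfl

theorem seq_natPair (p q : Part ℕ) :
    (Nat.pair <$> p <*> q) = p.bind fun a => q.map (Nat.pair a) := by
  simp [Seq.seq, Part.bind_map]

theorem crun_pair (f g : Code) (x : ℕ) :
    crun (.pair f g) x = (crun f x).bind fun a => (crun g x).map (Nat.pair a) :=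
  seq_natPair _ _

theorem crun_prec_zero (f g : Code) (a : ℕ) :
    crun (.prec f g) (Nat.pair a 0) = crun f a := Code.eval_prec_zero f g a

theorem crun_prec_succ (f g : Code) (a n : ℕ) :
    crun (.prec f g) (Nat.pair a (n + 1)) = (crun (.prec f g) (Nat.pair a n)).bind
      fun i => crun g (Nat.pair a (Nat.pair n i)) := Code.eval_prec_succ f g a n

theorem crun_rfind' (f : Code) (a m : ℕ) :
    crun (.rfind' f) (Nat.pair a m) = (Nat.rfind fun n =>
      (crun f (Nat.pair a (n + m))).map fun v => decide (v = 0)).map (· + m) := by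
  simp [crun, Code.eval]

theorem run_zero (O : ℕ → Part ℕ) (x : ℕ) : run O zero x = Part.some 0 := rfl

theorem run_succ (O : ℕ → Part ℕ) (x : ℕ) : run O succ x = Part.some (x + 1) := rfl

theorem run_left (O : ℕ → Part ℕ) (x : ℕ) : run O left x = Part.some x.unpair.1 := rfl

theorem run_right (O : ℕ → Part ℕ) (x : ℕ) : run O right x = Part.some x.unpair.2 := rfl

theorem run_oracle (O : ℕ → Part ℕ) (x : ℕ) : run O oracle x = O x := rfl

theorem run_comp (O : ℕ → Part ℕ) (f g : OracleCode) (x : ℕ) :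
    run O (comp f g) x = (run O g x).bind (run O f) := rfl

theorem run_pair (O : ℕ → Part ℕ) (f g : OracleCode) (x : ℕ) :
    run O (pair f g) x = (run O f x).bind fun a => (run O g x).map (Nat.pair a) :=
  seq_natPair _ _

theorem run_prec_zero (O : ℕ → Part ℕ) (f g : OracleCode) (a : ℕ) :
    run O (prec f g) (Nat.pair a 0) = run O f a := by
  simp [run, eval]

theorem run_prec_succ (O : ℕ → Part ℕ) (f g : OracleCode) (a n : ℕ) :
    run O (prec f g) (Nat.pair a (n + 1)) = (run O (prec f g) (Nat.pair a n)).bind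
      fun i => run O g (Nat.pair a (Nat.pair n i)) := by
  simp [run, eval]

theorem run_rfind' (O : ℕ → Part ℕ) (f : OracleCode) (a m : ℕ) :
    run O (rfind' f) (Nat.pair a m) = (Nat.rfind fun n =>
      (run O f (Nat.pair a (n + m))).map fun v => decide (v = 0)).map (· + m) := by
  simp [run, eval]

theorem mem_run_pair {O : ℕ → Part ℕ} {f g : OracleCode} {x y : ℕ} :
    y ∈ run O (pair f g) x ↔ ∃ a ∈ run O f x, ∃ b ∈ run O g x, Nat.pair a b = y := by
  simp [run_pair]

theorem mem_run_comp {O : ℕ → Part ℕ} {f g : OracleCode} {x y : ℕ} :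
    y ∈ run O (comp f g) x ↔ ∃ a ∈ run O g x, y ∈ run O f a := by
  rw [run_comp, Part.mem_bind_iff]

theorem mem_run_prec_succ {O : ℕ → Part ℕ} {f g : OracleCode} {a n y : ℕ} :
    y ∈ run O (prec f g) (Nat.pair a (n + 1)) ↔ ∃ i ∈ run O (prec f g) (Nat.pair a n),
      y ∈ run O g (Nat.pair a (Nat.pair n i)) := by
  rw [run_prec_succ, Part.mem_bind_iff]

theorem mem_run_rfind' {O : ℕ → Part ℕ} {f : OracleCode} {a m y : ℕ} :
    y ∈ run O (rfind' f) (Nat.pair a m) ↔ ∃ n, 0 ∈ run O f (Nat.pair a (n + m)) ∧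
      (∀ k < n, ∃ w ∈ run O f (Nat.pair a (k + m)), w ≠ 0) ∧ n + m = y := by
  rw [run_rfind', Part.mem_map_iff]
  refine exists_congr fun n => ?_
  refine (and_congr_left fun _ => Nat.mem_rfind).trans ?_
  simp [and_assoc]

theorem crun_assocCode (s a z : ℕ) :
    crun assocCode (Nat.pair s (Nat.pair a z)) = Part.some (Nat.pair (Nat.pair s a) z) := by
  simp [assocCode, crun_comp, crun_pair, crun_left, crun_right]

theorem crun_unassocCode (s a z : ℕ) :
    crun unassocCode (Nat.pair (Nat.pair s a) z) = Part.some (Nat.pair s (Nat.pair a z)) := by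
  simp [unassocCode, crun_comp, crun_pair, crun_left, crun_right]

/-- This makes step-bounded evaluation of ordinary programs available for oracle computations: the
parameter `s` can code a finite piece of an oracle. -/
theorem crun_translate (d : Code) (c : OracleCode) (s x : ℕ) :
    crun (translate d c) (Nat.pair s x) = run (fun n => crun d (Nat.pair s n)) c x := by
  have hr : crun (Code.right) (Nat.pair s x) = Part.some x := by simp [crun_right]
  have hl : crun (Code.left) (Nat.pair s x) = Part.some s := by simp [crun_left]
  induction c generalizing x with
  | zero => rfl
  | succ | left | right => rw [translate, crun_comp, hr, Part.bind_some]; rfl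
  | oracle => rfl
  | pair f g hf hg =>
    rw [translate, crun_pair, run_pair, hf x hr hl, hg x hr hl]
  | comp f g hf hg =>
    rw [translate, crun_comp, crun_pair, run_comp, hg x hr hl, hl, Part.bind_some,
      Part.bind_map]
    congr 1
    funext y
    exact hf y (by simp [crun_right]) (by simp [crun_left])
  | prec f g hf hg =>
    obtain ⟨a, n, rfl⟩ : ∃ a n, x = Nat.pair a n := ⟨_, _, (Nat.pair_unpair x).symm⟩
    rw [translate, crun_comp, crun_assocCode, Part.bind_some]
    clear hr hl
    induction n with
    | zero =>
      rw [crun_prec_zero, run_prec_zero]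
      exact hf a (by simp [crun_right]) (by simp [crun_left])
    | succ n ih =>
      rw [crun_prec_succ, run_prec_succ, ih]
      refine congrArg _ (funext fun i => ?_)
      rw [crun_comp, crun_unassocCode, Part.bind_some]
      exact hg _ (by simp [crun_right]) (by simp [crun_left])
  | rfind' f hf =>
    obtain ⟨a, n, rfl⟩ : ∃ a n, x = Nat.pair a n := ⟨_, _, (Nat.pair_unpair x).symm⟩
    rw [translate, crun_comp, crun_assocCode, Part.bind_some, crun_rfind', run_rfind']
    refine congrArg _ (congrArg _ (funext fun i => ?_))
    rw [crun_comp, crun_unassocCode, Part.bind_some,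
      hf _ (by simp [crun_right]) (by simp [crun_left])]

/-- One step of the course-of-values recursion that computes `translate d`. -/
def translateStep (d : Code) (l : List Code) : Code :=
  -- The list holds the translations of all smaller code numbers, and its length is the current one.
  -- From length 5 on, the indices looked up below are smaller than the length, so the default
  -- `.zero` is never used.
  let n := l.length - 5
  let m := n.div2.div2
  let c := l.getD m .zero
  let c₁ := l.getD m.unpair.1 .zero
  let c₂ := l.getD m.unpair.2 .zero
  if l.length = 0 then .zero else
  if l.length = 1 then .comp .succ .right else
  if l.length = 2 then .comp .left .right else
  if l.length = 3 then .comp .right .right else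
  if l.length = 4 then d else
  bif n.bodd then
    bif n.div2.bodd then .comp (.rfind' (.comp c unassocCode)) assocCode
    else .comp (.prec c₁ (.comp c₂ unassocCode)) assocCode
  else
    bif n.div2.bodd then .comp c₁ (.pair .left c₂)
    else .pair c₁ c₂

theorem primrec_translateStep (d : Code) : Primrec (translateStep d) := by
  have hl : Primrec (fun l : List Code => l.length) := Primrec.list_length
  have hn : Primrec (fun l : List Code => l.length - 5) :=
    Primrec.nat_sub.comp hl (Primrec.const 5)
  have hm : Primrec (fun l : List Code => (l.length - 5).div2.div2) :=
    Primrec.nat_div2.comp (Primrec.nat_div2.comp hn)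
  have hc : Primrec (fun l : List Code => l.getD (l.length - 5).div2.div2 .zero) :=
    (Primrec.list_getD _).comp Primrec.id hm
  have hc₁ : Primrec (fun l : List Code => l.getD (l.length - 5).div2.div2.unpair.1 .zero) :=
    (Primrec.list_getD _).comp Primrec.id (Primrec.fst.comp (Primrec.unpair.comp hm))
  have hc₂ : Primrec (fun l : List Code => l.getD (l.length - 5).div2.div2.unpair.2 .zero) :=
    (Primrec.list_getD _).comp Primrec.id (Primrec.snd.comp (Primrec.unpair.comp hm))
  have hz (k : ℕ) : PrimrecPred (fun l : List Code => l.length = k) :=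
    Primrec.eq.comp hl (Primrec.const k)
  have hb : Primrec (fun l : List Code => (l.length - 5).bodd) := Primrec.nat_bodd.comp hn
  have hb' : Primrec (fun l : List Code => (l.length - 5).div2.bodd) :=
    Primrec.nat_bodd.comp (Primrec.nat_div2.comp hn)
  have comp {f g : List Code → Code} (hf : Primrec f) (hg : Primrec g) :
      Primrec fun l => Code.comp (f l) (g l) := Code.primrec₂_comp.comp hf hg
  have pair {f g : List Code → Code} (hf : Primrec f) (hg : Primrec g) :
      Primrec fun l => Code.pair (f l) (g l) := Code.primrec₂_pair.comp hf hg
  have prec {f g : List Code → Code} (hf : Primrec f) (hg : Primrec g) :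
      Primrec fun l => Code.prec (f l) (g l) := Code.primrec₂_prec.comp hf hg
  have c (x : Code) : Primrec (fun _ : List Code => x) := Primrec.const x
  exact .ite (hz 0) (c _) <| .ite (hz 1) (c _) <| .ite (hz 2) (c _) <| .ite (hz 3) (c _) <|
    .ite (hz 4) (c _) <| .cond hb
      (.cond hb' (comp (Code.primrec_rfind'.comp (comp hc (c _))) (c _))
        (comp (prec hc₁ (comp hc₂ (c _))) (c _)))
      (.cond hb' (comp hc₁ (pair (c _) hc₂)) (pair hc₁ hc₂))

theorem translateStep_range (d : Code) (n : ℕ) :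
    translateStep d ((List.range n).map fun k => translate d (ofNatCode k)) =
      translate d (ofNatCode n) := by
  match n with
  | 0 => simp [translateStep, ofNatCode, translate]
  | 1 => simp [translateStep, ofNatCode, translate]
  | 2 => simp [translateStep, ofNatCode, translate]
  | 3 => simp [translateStep, ofNatCode, translate]
  | 4 => simp [translateStep, ofNatCode, translate]
  | n + 5 =>
    have hm : n.div2.div2 < n + 5 := by
      simp only [Nat.div2_val]
      omega
    have h₁ : n.div2.div2.unpair.1 < n + 5 := lt_of_le_of_lt (Nat.unpair_left_le _) hm
    have h₂ : n.div2.div2.unpair.2 < n + 5 := lt_of_le_of_lt (Nat.unpair_right_le _) hm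
    have hget : ∀ i < n + 5, ((List.range (n + 5)).map
        fun k => translate d (ofNatCode k)).getD i .zero = translate d (ofNatCode i) := by
      intro i hi
      simp [List.getD, hi]
    simp only [translateStep, List.length_map, List.length_range, Nat.add_sub_cancel,
      hget _ hm, hget _ h₁, hget _ h₂, ofNatCode.eq_6]
    cases n.bodd <;> cases n.div2.bodd <;> simp [translate]

/-- Course-of-values recursion on code numbers. It is needed for the matrix of the `∃∀`-definition
of `∅''` to be primitive recursive. -/
theorem primrec_translate (d : Code) : Primrec fun n => translate d (ofNat OracleCode n) := by
  have : Primrec₂ fun (_ : Unit) n => translate d (ofNatCode n) :=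
    Primrec.nat_strong_rec (g := fun _ l => some (translateStep d l)) _
      (Primrec.option_some.comp ((primrec_translateStep d).comp Primrec.snd))
      fun _ n => by rw [translateStep_range]
  exact this.comp (Primrec.const ()) Primrec.id

/-! ### Dependence of an oracle computation on the oracle -/

/-- Extending the oracle preserves every answer already received, including the nonzero values that
an unbounded search passes. This gives the passage from a finite string to the full oracle. -/
theorem run_mono {O O' : ℕ → Part ℕ} (h : ∀ n, ∀ y ∈ O n, y ∈ O' n) (c : OracleCode) :
    ∀ x, ∀ y ∈ run O c x, y ∈ run O' c x := by
  induction c with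
  | zero | succ | left | right => exact fun x y hy => hy
  | oracle => exact h
  | pair f g hf hg =>
    intro x y hy
    obtain ⟨a, ha, b, hb, rfl⟩ := mem_run_pair.1 hy
    exact mem_run_pair.2 ⟨a, hf _ _ ha, b, hg _ _ hb, rfl⟩
  | comp f g hf hg =>
    intro x y hy
    obtain ⟨a, ha, hy⟩ := mem_run_comp.1 hy
    exact mem_run_comp.2 ⟨a, hg _ _ ha, hf _ _ hy⟩
  | prec f g hf hg =>
    intro x
    obtain ⟨a, n, rfl⟩ : ∃ a n, x = Nat.pair a n := ⟨_, _, (Nat.pair_unpair x).symm⟩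
    induction n with
    | zero => simpa only [run_prec_zero] using hf a
    | succ n ih =>
      intro y hy
      obtain ⟨i, hi, hy⟩ := mem_run_prec_succ.1 hy
      exact mem_run_prec_succ.2 ⟨i, ih _ hi, hg _ _ hy⟩
  | rfind' f hf =>
    intro x y hy
    obtain ⟨a, m, rfl⟩ : ∃ a n, x = Nat.pair a n := ⟨_, _, (Nat.pair_unpair x).symm⟩
    obtain ⟨n, h0, hn, rfl⟩ := mem_run_rfind'.1 hy
    refine mem_run_rfind'.2 ⟨n, hf _ _ h0, fun k hk => ?_, rfl⟩
    obtain ⟨w, hw, hw'⟩ := hn k hk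
    exact ⟨w, hf _ _ hw, hw'⟩

/-- The restriction of an oracle to the numbers below `L`. -/
def restrict (O : ℕ → Part ℕ) (L : ℕ) : ℕ → Part ℕ := fun n => if n < L then O n else Part.none

theorem restrict_mono (O : ℕ → Part ℕ) {L L' : ℕ} (h : L ≤ L') (n : ℕ) :
    ∀ y ∈ restrict O L n, y ∈ restrict O L' n := by
  intro y hy
  unfold restrict at hy ⊢
  split_ifs at hy with hn
  · rwa [if_pos (lt_of_lt_of_le hn h)]
  · exact absurd hy (Part.notMem_none _)

theorem run_restrict_mono {O : ℕ → Part ℕ} {L L' : ℕ} (h : L ≤ L') {c : OracleCode} {x y : ℕ}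
    (hy : y ∈ run (restrict O L) c x) : y ∈ run (restrict O L') c x :=
  run_mono (restrict_mono O h) c x y hy

/-- The use principle: a halting computation asks finitely many questions to the oracle. -/
theorem exists_run_restrict {O : ℕ → Part ℕ} (c : OracleCode) :
    ∀ x, ∀ y ∈ run O c x, ∃ L, y ∈ run (restrict O L) c x := by
  induction c with
  | zero | succ | left | right => exact fun x y hy => ⟨0, hy⟩
  | oracle =>
    intro x y hy
    refine ⟨x + 1, ?_⟩
    simpa [run_oracle, restrict] using hy
  | pair f g hf hg =>
    intro x y hy
    obtain ⟨a, ha, b, hb, rfl⟩ := mem_run_pair.1 hy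
    obtain ⟨L, hL⟩ := hf _ _ ha
    obtain ⟨L', hL'⟩ := hg _ _ hb
    exact ⟨max L L', mem_run_pair.2 ⟨a, run_restrict_mono (le_max_left _ _) hL, b,
      run_restrict_mono (le_max_right _ _) hL', rfl⟩⟩
  | comp f g hf hg =>
    intro x y hy
    obtain ⟨a, ha, hy⟩ := mem_run_comp.1 hy
    obtain ⟨L, hL⟩ := hg _ _ ha
    obtain ⟨L', hL'⟩ := hf _ _ hy
    exact ⟨max L L', mem_run_comp.2 ⟨a, run_restrict_mono (le_max_left _ _) hL,
      run_restrict_mono (le_max_right _ _) hL'⟩⟩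
  | prec f g hf hg =>
    intro x
    obtain ⟨a, n, rfl⟩ : ∃ a n, x = Nat.pair a n := ⟨_, _, (Nat.pair_unpair x).symm⟩
    induction n with
    | zero => simpa only [run_prec_zero] using hf a
    | succ n ih =>
      intro y hy
      obtain ⟨i, hi, hy⟩ := mem_run_prec_succ.1 hy
      obtain ⟨L, hL⟩ := ih _ hi
      obtain ⟨L', hL'⟩ := hg _ _ hy
      exact ⟨max L L', mem_run_prec_succ.2 ⟨i, run_restrict_mono (le_max_left _ _) hL,
        run_restrict_mono (le_max_right _ _) hL'⟩⟩
  | rfind' f hf =>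
    intro x y hy
    obtain ⟨a, m, rfl⟩ : ∃ a n, x = Nat.pair a n := ⟨_, _, (Nat.pair_unpair x).symm⟩
    obtain ⟨n, h0, hn, rfl⟩ := mem_run_rfind'.1 hy
    -- The search runs finitely many subcomputations, so the supremum of their bounds suffices. The
    -- implication makes the chosen bound a function on all of `ℕ`.
    have hn' : ∀ k, ∃ L, k < n → ∃ w ∈ run (restrict O L) f (Nat.pair a (k + m)), w ≠ 0 := by
      intro k
      by_cases hk : k < n
      · obtain ⟨w, hw, hw'⟩ := hn k hk
        obtain ⟨L, hL⟩ := hf _ _ hw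
        exact ⟨L, fun _ => ⟨w, hL, hw'⟩⟩
      · exact ⟨0, fun h => absurd h hk⟩
    choose F hF using hn'
    obtain ⟨L, hL⟩ := hf _ _ h0
    refine ⟨max L ((Finset.range n).sup F), mem_run_rfind'.2
      ⟨n, run_restrict_mono (le_max_left _ _) hL, fun k hk => ?_, rfl⟩⟩
    obtain ⟨w, hw, hw'⟩ := hF k hk
    exact ⟨w, run_restrict_mono
      ((Finset.le_sup (f := F) (Finset.mem_range.2 hk)).trans (le_max_right _ _)) hw, hw'⟩

/-! ### Existence of oracle programs and the s-m-n theorem -/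

theorem exists_code {O f : ℕ → Part ℕ} (hf : Nat.RecursiveIn {O} f) :
    ∃ c : OracleCode, run O c = f := by
  induction hf with
  | zero => exact ⟨zero, rfl⟩
  | succ => exact ⟨succ, rfl⟩
  | left => exact ⟨left, rfl⟩
  | right => exact ⟨right, rfl⟩
  | oracle g hg =>
    obtain rfl : g = O := hg
    exact ⟨oracle, rfl⟩
  | pair _ _ hf hg =>
    obtain ⟨cf, rfl⟩ := hf
    obtain ⟨cg, rfl⟩ := hg
    exact ⟨pair cf cg, rfl⟩
  | comp _ _ hf hg =>
    obtain ⟨cf, rfl⟩ := hf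
    obtain ⟨cg, rfl⟩ := hg
    exact ⟨comp cf cg, rfl⟩
  | prec _ _ hf hg =>
    obtain ⟨cf, rfl⟩ := hf
    obtain ⟨cg, rfl⟩ := hg
    exact ⟨prec cf cg, rfl⟩
  | rfind _ hf =>
    obtain ⟨cf, rfl⟩ := hf
    -- `rfind'` starts its search at the second entry of its input, so it is fed `(n, 0)`.
    refine ⟨comp (rfind' cf) (pair (pair left right) zero), ?_⟩
    funext n
    have h : run O (pair (pair left right) zero) n = Part.some (Nat.pair n 0) := by
      simp [run_pair, run_left, run_right, run_zero]
    rw [run_comp, h, Part.bind_some, run_rfind']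
    simp [Part.map_id']

/-- The program that outputs the constant `n`. -/
def const : ℕ → OracleCode
  | 0 => zero
  | n + 1 => comp succ (const n)

theorem run_const (O : ℕ → Part ℕ) (n x : ℕ) : run O (const n) x = Part.some n := by
  induction n with
  | zero => rfl
  | succ n ih => simp [const, run_comp, ih, run_succ]

theorem primrec₂_comp : Primrec₂ comp := by
  refine Primrec₂.encode_iff.1 ?_
  have : Primrec₂ fun a b : OracleCode => 2 * (2 * Nat.pair (encode a) (encode b) + 1) + 5 :=
    Primrec.nat_add.comp (Primrec.nat_double.comp (Primrec.nat_double_succ.comp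
      (Primrec₂.natPair.comp (Primrec.encode.comp Primrec.fst)
        (Primrec.encode.comp Primrec.snd)))) (Primrec.const 5)
  exact this

theorem primrec_const : Primrec const :=
  (Primrec.nat_rec₁ (f := fun _ c => comp succ c) zero
    (primrec₂_comp.comp (Primrec.const succ) Primrec.snd)).of_eq fun n => by
    induction n with
    | zero => rfl
    | succ n ih => simp [const, ← ih]

/-- A set that is computably enumerable relative to `X` is many-one reducible to `X'`. -/
theorem exists_primrec_mem_jump {X : Set ℕ} {g : ℕ → Part ℕ} (hg : Nat.RecursiveIn {charFun X} g) :
    ∃ f : ℕ → ℕ, Primrec f ∧ ∀ n, f n ∈ jump X ↔ (g n).Dom := by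
  obtain ⟨c, rfl⟩ := exists_code hg
  refine ⟨fun n => encode (comp c (const n)), Primrec.encode.comp
    (primrec₂_comp.comp (Primrec.const c) primrec_const), fun n => ?_⟩
  change (run (charFun X) (ofNat OracleCode (encode (comp c (const n))))
    (encode (comp c (const n)))).Dom ↔ _
  -- The program ignores its own input, so running it on its own code number, as the jump does,
  -- evaluates `c` at `n`.
  have key : ∀ (O : ℕ → Part ℕ) (x : ℕ), run O (comp c (const n)) x = run O c n := by
    intro O x
    rw [run_comp, run_const, Part.bind_some]
  rw [ofNat_encode]
  exact iff_of_eq (congrArg Part.Dom (key _ _))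

end OracleCode
end UHFComp

/-! ### Reduction of `∅''` to finiteness of c.e. sets. -/

namespace UHFComp

/-! ### Primitive recursive and computable functions -/

theorem primrecRel_exists_lt {α : Type*} [Primcodable α] {R : ℕ → α → Prop} (hR : PrimrecRel R) :
    PrimrecRel fun n a => ∃ x < n, R x a :=
  PrimrecPred.of_eq (hR.exists_mem_list.comp (Primrec.list_range.comp Primrec.fst) Primrec.snd)
    (by simp)

theorem primrecRel_forall_lt {α : Type*} [Primcodable α] {R : ℕ → α → Prop} (hR : PrimrecRel R) :
    PrimrecRel fun n a => ∀ x < n, R x a :=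
  PrimrecPred.of_eq (hR.forall_mem_list.comp (Primrec.list_range.comp Primrec.fst) Primrec.snd)
    (by simp)

theorem primrec_count {α : Type*} [Primcodable α] {R : α → ℕ → Prop} [∀ a, DecidablePred (R a)]
    (hR : PrimrecRel R) {f : α → ℕ} (hf : Primrec f) :
    Primrec fun a => Nat.count (R a) (f a) := by
  have hstep : Primrec₂ fun (a : α) (p : ℕ × ℕ) => p.2 + if R a p.1 then 1 else 0 :=
    Primrec.nat_add.comp (Primrec.snd.comp Primrec.snd)
      (Primrec.ite (hR.comp Primrec.fst (Primrec.fst.comp Primrec.snd)) (Primrec.const 1)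
        (Primrec.const 0))
  refine (Primrec.nat_rec' hf (Primrec.const 0) hstep).of_eq fun a => ?_
  induction f a with
  | zero => rfl
  | succ n ih => rw [Nat.count_succ, ← ih]

/-- Unbounded search for a witness of a primitive recursive relation. -/
theorem exists_computable_choice {α : Type*} [Primcodable α] {R : α → ℕ → Prop}
    (hR : PrimrecRel R) (h : ∀ a, ∃ n, R a n) : ∃ f : α → ℕ, Computable f ∧ ∀ a, R a (f a) := by
  classical
  refine ⟨fun a => Nat.find (h a), ?_, fun a => Nat.find_spec (h a)⟩
  have hp : Partrec₂ fun (a : α) (n : ℕ) => (Part.some (decide (R a n)) : Part Bool) :=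
    (show Primrec₂ fun (a : α) (n : ℕ) => decide (R a n) from hR.decide).to_comp.partrec
  refine (Partrec.rfind hp).of_eq_tot fun a => ?_
  refine Nat.mem_rfind.2 ⟨?_, fun {m} hm => ?_⟩
  · simpa using Nat.find_spec (h a)
  · simpa using Nat.find_min (h a) hm

/-- A uniformly computably enumerable family of sets, given by a primitive recursive relation, is
a computable reindexing of the sets `W e`. -/
theorem exists_primrec_W {Q : ℕ × ℕ → ℕ → Prop} (hQ : PrimrecRel Q) :
    ∃ f : ℕ → ℕ, Primrec f ∧ ∀ e m, m ∈ W (f e) ↔ ∃ s, Q (e, m) s := by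
  classical
  have hp : Partrec₂ fun (a : ℕ) (n : ℕ) => (Part.some (decide (Q a.unpair n)) : Part Bool) :=
    (show Primrec₂ fun (a : ℕ) (n : ℕ) => decide (Q a.unpair n) from
      (hQ.comp (Primrec.unpair.comp Primrec.fst) Primrec.snd).decide).to_comp.partrec
  obtain ⟨c, hc⟩ := Nat.Partrec.Code.exists_code.1 (Partrec.nat_iff.1 (Partrec.rfind hp))
  refine ⟨fun e => encode (c.curry e), Primrec.encode.comp
    (Nat.Partrec.Code.primrec₂_curry.comp (Primrec.const c) Primrec.id), fun e m => ?_⟩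
  change (Nat.Partrec.Code.eval (ofNat _ (encode (c.curry e))) m).Dom ↔ _
  rw [ofNat_encode, Nat.Partrec.Code.eval_curry, hc]
  rw [Part.dom_iff_mem]
  constructor
  · rintro ⟨s, hs⟩
    exact ⟨s, by simpa using (Nat.mem_rfind.1 hs).1⟩
  · intro hs
    refine ⟨Nat.find hs, Nat.mem_rfind.2 ⟨?_, fun {k} hk => ?_⟩⟩
    · simpa using Nat.find_spec hs
    · simpa using Nat.find_min hs hk

/-! ### The first and second jump in terms of ordinary programs -/

open Nat.Partrec (Code)
open OracleCode

/-- `c` halts on `x` within `t` steps. -/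
def HaltsIn (t : ℕ) (c : Code) (x : ℕ) : Prop := (Code.evaln t c x).isSome

theorem HaltsIn.mono {t t' : ℕ} (h : t ≤ t') {c : Code} {x : ℕ} (ht : HaltsIn t c x) :
    HaltsIn t' c x := by
  obtain ⟨y, hy⟩ := Option.isSome_iff_exists.1 ht
  exact Option.isSome_iff_exists.2 ⟨y, Code.evaln_mono h hy⟩

theorem dom_crun_iff {c : Code} {x : ℕ} : (crun c x).Dom ↔ ∃ t, HaltsIn t c x := by
  rw [Part.dom_iff_mem]
  constructor
  · rintro ⟨y, hy⟩
    obtain ⟨t, ht⟩ := Code.evaln_complete.1 hy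
    exact ⟨t, Option.isSome_iff_exists.2 ⟨y, ht⟩⟩
  · rintro ⟨t, ht⟩
    obtain ⟨y, hy⟩ := Option.isSome_iff_exists.1 ht
    exact ⟨y, Code.evaln_sound hy⟩

theorem primrecPred_haltsIn {α : Type*} [Primcodable α] {t x : α → ℕ} {c : α → Code}
    (ht : Primrec t) (hc : Primrec c) (hx : Primrec x) :
    PrimrecPred fun a => HaltsIn (t a) (c a) (x a) :=
  Primrec.eq.comp (Primrec.option_isSome.comp
    (Code.primrec_evaln.comp (Primrec.pair (Primrec.pair ht hc) hx))) (Primrec.const true)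

instance (t : ℕ) (c : Code) (x : ℕ) : Decidable (HaltsIn t c x) :=
  inferInstanceAs (Decidable (_ = true))

theorem mem_W_iff {e m : ℕ} : m ∈ W e ↔ ∃ t, HaltsIn t (ofNat Code e) m := dom_crun_iff

/-- `n` has entered `∅'` by stage `t`. -/
def JumpIn (t n : ℕ) : Prop := HaltsIn t (translate .zero (ofNat OracleCode n)) (Nat.pair 0 n)

theorem JumpIn.mono {t t' n : ℕ} (h : t ≤ t') (ht : JumpIn t n) : JumpIn t' n := HaltsIn.mono h ht

theorem primrecRel_jumpIn : PrimrecRel JumpIn :=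
  primrecPred_haltsIn Primrec.fst ((primrec_translate _).comp Primrec.snd)
    (Primrec₂.natPair.comp (Primrec.const 0) Primrec.snd)

theorem charFun_apply_of_mem {X : Set ℕ} {n : ℕ} (h : n ∈ X) : charFun X n = Part.some 1 := by
  simp [charFun, h]

theorem charFun_apply_of_notMem {X : Set ℕ} {n : ℕ} (h : n ∉ X) :
    charFun X n = Part.some 0 := by
  simp [charFun, h]

theorem mem_jump_iff {X : Set ℕ} {e : ℕ} :
    e ∈ jump X ↔ (run (charFun X) (ofNat OracleCode e) e).Dom := Iff.rfl

/-- The characteristic function of `∅` is constantly zero, hence computed by the program `.zero`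
whatever the parameter. -/
theorem mem_jump_empty_iff {n : ℕ} : n ∈ jump ∅ ↔ ∃ t, JumpIn t n := by
  have h : (charFun ∅ : ℕ → Part ℕ) = fun k => crun .zero (Nat.pair 0 k) :=
    funext fun k => charFun_apply_of_notMem (Set.notMem_empty k)
  rw [mem_jump_iff]
  erw [h]
  rw [← crun_translate, dom_crun_iff]
  rfl

/-- A finite string as a partial oracle: a question beyond its length makes the computation diverge,
so a halting run has used only the entries of the string. -/
theorem exists_code_list_getElem :
    ∃ d : Code, ∀ s n, crun d (Nat.pair s n) = ((ofNat (List ℕ) s)[n]? : Part ℕ) := by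
  have h : Partrec fun a : ℕ => (((ofNat (List ℕ) a.unpair.1)[a.unpair.2]? : Option ℕ) : Part ℕ) :=
    (Primrec.list_getElem?.comp ((Primrec.ofNat _).comp (Primrec.fst.comp Primrec.unpair))
      (Primrec.snd.comp Primrec.unpair)).to_comp.ofOption
  obtain ⟨d, hd⟩ := Code.exists_code.1 (Partrec.nat_iff.1 h)
  refine ⟨d, fun s n => ?_⟩
  rw [crun, hd]
  simp

/-- `v` is the value at `n` of the characteristic function of `∅'`, according to the stages `t`
(for positive information) and `s` (for negative information). -/
def Correct (t s n v : ℕ) : Prop := (v = 1 ∧ JumpIn t n) ∨ (v = 0 ∧ ¬ JumpIn s n)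

/-- The matrix of a `∃∀`-definition of `0''`. -/
def DoubleJumpMatrix (d : Code) (e z s : ℕ) : Prop :=
  HaltsIn z.unpair.2 (translate d (ofNat OracleCode e)) (Nat.pair z.unpair.1 e) ∧
    ∀ n < (ofNat (List ℕ) z.unpair.1).length,
      Correct z.unpair.2 s n ((ofNat (List ℕ) z.unpair.1).getD n 0)

theorem primrec_doubleJumpMatrix (d : Code) :
    PrimrecRel fun (p : ℕ × ℕ) (s : ℕ) => DoubleJumpMatrix d p.1 p.2 s := by
  have hz : Primrec fun q : (ℕ × ℕ) × ℕ => q.1.2.unpair :=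
    Primrec.unpair.comp (Primrec.snd.comp Primrec.fst)
  have hl : Primrec fun q : (ℕ × ℕ) × ℕ => ofNat (List ℕ) q.1.2.unpair.1 :=
    (Primrec.ofNat _).comp (Primrec.fst.comp hz)
  have he : Primrec fun q : (ℕ × ℕ) × ℕ => q.1.1 := Primrec.fst.comp Primrec.fst
  refine PrimrecPred.and (primrecPred_haltsIn (Primrec.snd.comp hz)
    ((primrec_translate d).comp he) (Primrec₂.natPair.comp (Primrec.fst.comp hz) he)) ?_
  have hv : Primrec fun r : ℕ × ((ℕ × ℕ) × ℕ) => (ofNat (List ℕ) r.2.1.2.unpair.1).getD r.1 0 :=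
    (Primrec.list_getD 0).comp (hl.comp Primrec.snd) Primrec.fst
  have hc : PrimrecRel fun (n : ℕ) (q : (ℕ × ℕ) × ℕ) =>
      Correct q.1.2.unpair.2 q.2 n ((ofNat (List ℕ) q.1.2.unpair.1).getD n 0) :=
    PrimrecPred.or
      (PrimrecPred.and (Primrec.eq.comp hv (Primrec.const 1))
        (primrecRel_jumpIn.comp ((Primrec.snd.comp hz).comp Primrec.snd) Primrec.fst))
      (PrimrecPred.and (Primrec.eq.comp hv (Primrec.const 0))
        (PrimrecPred.not (primrecRel_jumpIn.comp (Primrec.snd.comp Primrec.snd) Primrec.fst)))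
  exact (primrecRel_forall_lt hc).comp (Primrec.list_length.comp hl) Primrec.id

/-- Positive claims are verified at the fixed stage `t`; a false negative claim is exposed at the
stage `s` where `n` enters `∅'`. -/
theorem charFun_jump_empty_of_correct {t n v : ℕ} (h : ∀ s, Correct t s n v) :
    charFun (jump ∅) n = Part.some v := by
  by_cases hn : n ∈ jump ∅
  · rw [charFun_apply_of_mem hn]
    obtain ⟨s, hs⟩ := mem_jump_empty_iff.1 hn
    rcases h s with ⟨rfl, -⟩ | ⟨-, h'⟩
    · rfl
    · exact absurd hs h'
  · rw [charFun_apply_of_notMem hn]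
    rcases h 0 with ⟨-, h'⟩ | ⟨rfl, -⟩
    · exact absurd (mem_jump_empty_iff.2 ⟨t, h'⟩) hn
    · rfl

/-- The value at `n` of the characteristic function of `∅'`. -/
noncomputable def jumpVal (n : ℕ) : ℕ := open Classical in if n ∈ jump ∅ then 1 else 0

/-- Validity at all later stages lets a single stage serve finitely many `n` at once. -/
theorem exists_correct (n : ℕ) : ∃ t, ∀ t' ≥ t, ∀ s, Correct t' s n (jumpVal n) := by
  by_cases hn : n ∈ jump ∅
  · obtain ⟨t, ht⟩ := mem_jump_empty_iff.1 hn
    exact ⟨t, fun t' h' s => Or.inl ⟨by simp [jumpVal, hn], ht.mono h'⟩⟩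
  · exact ⟨0, fun t' _ s => Or.inr ⟨by simp [jumpVal, hn],
      fun h => hn (mem_jump_empty_iff.2 ⟨s, h⟩)⟩⟩

/-- By the use principle, membership in `∅''` is witnessed by an initial segment of `∅'` and a
stage; `z` codes this pair, and the universal quantifier over `s` checks the negative entries. -/
theorem exists_sigma_two_matrix :
    ∃ R : ℕ × ℕ → ℕ → Prop, PrimrecRel R ∧
      ∀ e, e ∈ jump (jump ∅) ↔ ∃ z, ∀ s, R (e, z) s := by
  obtain ⟨d, hd⟩ := exists_code_list_getElem
  refine ⟨_, primrec_doubleJumpMatrix d, fun e => ?_⟩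
  have key : ∀ σ, crun (translate d (ofNat OracleCode e)) (Nat.pair σ e) =
      run (fun n => ((ofNat (List ℕ) σ)[n]? : Part ℕ)) (ofNat OracleCode e) e := by
    intro σ
    rw [crun_translate]
    simp only [hd]
  rw [mem_jump_iff, Part.dom_iff_mem]
  constructor
  · rintro ⟨y, hy⟩
    obtain ⟨L, hL⟩ := exists_run_restrict _ _ _ hy
    choose t ht using exists_correct
    have hlist : (restrict (charFun (jump ∅)) L : ℕ → Part ℕ) =
        fun n => (((List.range L).map jumpVal)[n]? : Part ℕ) := by
      funext n
      by_cases hn : n < L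
      · have : ((List.range L).map jumpVal)[n]? = some (jumpVal n) := by simp [hn]
        rw [this]
        exact if_pos hn
      · simp [restrict, hn]
    rw [hlist] at hL
    have hh := key (encode ((List.range L).map jumpVal))
    rw [ofNat_encode] at hh
    rw [← hh] at hL
    obtain ⟨t₀, ht₀⟩ := dom_crun_iff.1 (Part.dom_iff_mem.2 ⟨y, hL⟩)
    -- The stage exceeds both the halting time and the stages that confirm each entry below `L`.
    refine ⟨Nat.pair (encode ((List.range L).map jumpVal)) (max t₀ ((Finset.range L).sup t)),
      fun s => ⟨?_, ?_⟩⟩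
    · simpa using ht₀.mono (le_max_left _ _)
    · simp only [Nat.unpair_pair, ofNat_encode, List.length_map, List.length_range]
      intro n hn
      simpa [List.getD, hn] using ht n _
        ((Finset.le_sup (f := t) (Finset.mem_range.2 hn)).trans (le_max_right _ _)) s
  · rintro ⟨z, hz⟩
    have hdom := dom_crun_iff.2 ⟨_, (hz 0).1⟩
    rw [key] at hdom
    obtain ⟨y, hy⟩ := Part.dom_iff_mem.1 hdom
    -- Every entry of the string agrees with `∅'`, so the true oracle extends it and the computation
    -- persists.
    refine ⟨y, run_mono (fun n v hv => ?_) _ _ _ hy⟩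
    rw [Part.mem_coe, Option.mem_def] at hv
    obtain ⟨hn, hv'⟩ := List.getElem?_eq_some_iff.1 hv
    have := charFun_jump_empty_of_correct fun s => (hz s).2 n hn
    rw [List.getD, hv, Option.getD_some] at this
    rw [this]
    exact Part.mem_some v

/-- `0''` is many-one reducible to the set of indices of finite c.e. sets. -/
theorem exists_primrec_finite_W :
    ∃ f : ℕ → ℕ, Primrec f ∧ ∀ e, e ∈ jump (jump ∅) ↔ (W (f e)).Finite := by
  obtain ⟨R, hR, hjump⟩ := exists_sigma_two_matrix
  -- The enumerated set is an initial segment: `m` enters once every `z ≤ m` has been refuted. It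
  -- stops growing exactly at a `z` that is never refuted. The common bound `s'` keeps the relation
  -- primitive recursive.
  have hQ : PrimrecRel fun (p : ℕ × ℕ) (s' : ℕ) => ∀ z < p.2 + 1, ∃ s < s', ¬ R (p.1, z) s := by
    have h₁ : PrimrecRel fun (s : ℕ) (q : ℕ × ((ℕ × ℕ) × ℕ)) => ¬ R (q.2.1.1, q.1) s :=
      PrimrecPred.not (hR.comp (Primrec.pair
        (Primrec.fst.comp (Primrec.fst.comp (Primrec.snd.comp Primrec.snd)))
        (Primrec.fst.comp Primrec.snd)) Primrec.fst)
    have h₂ : PrimrecRel fun (z : ℕ) (q : (ℕ × ℕ) × ℕ) => ∃ s < q.2, ¬ R (q.1.1, z) s :=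
      (primrecRel_exists_lt h₁).comp (Primrec.snd.comp Primrec.snd) Primrec.id
    exact (primrecRel_forall_lt h₂).comp (Primrec.succ.comp (Primrec.snd.comp Primrec.fst))
      Primrec.id
  obtain ⟨f, hf, hW⟩ := exists_primrec_W hQ
  refine ⟨f, hf, fun e => ?_⟩
  have hmem : ∀ m, m ∈ W (f e) ↔ ∀ z ≤ m, ∃ s, ¬ R (e, z) s := by
    intro m
    rw [hW]
    constructor
    · rintro ⟨s', hs'⟩ z hz
      obtain ⟨s, -, hs⟩ := hs' z (Nat.lt_succ_of_le hz)
      exact ⟨s, hs⟩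
    · intro h
      choose! g hg using h
      refine ⟨(Finset.range (m + 1)).sup g + 1, fun z hz => ⟨g z, ?_, hg z (Nat.le_of_lt_succ hz)⟩⟩
      exact Nat.lt_succ_of_le (Finset.le_sup (Finset.mem_range.2 hz))
  rw [hjump]
  constructor
  · rintro ⟨z, hz⟩
    refine (Set.finite_lt_nat z).subset fun m hm => ?_
    by_contra hlt
    obtain ⟨s, hs⟩ := (hmem m).1 hm z (not_lt.1 hlt)
    exact hs (hz s)
  · intro hfin
    by_contra! hcon
    refine Set.infinite_univ (hfin.subset fun m _ => (hmem m).2 fun z _ => hcon z)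

end UHFComp

/-! ### Turing degree and noncomputability of `p_e ↦ |W_e|`. -/

namespace UHFComp
open Nat.Partrec (Code)
open OracleCode

/-! ### Total functions recursive in an oracle -/

/-- The total function `f` is recursive in `O`. -/
def TotalRecursiveIn (O : ℕ →. ℕ) (f : ℕ → ℕ) : Prop := Nat.RecursiveIn {O} fun n => Part.some (f n)

namespace TotalRecursiveIn

variable {O : ℕ →. ℕ} {f g : ℕ → ℕ}

theorem of_computable (hf : Computable f) : TotalRecursiveIn O f :=
  (Partrec.nat_iff.1 hf).recursiveIn

theorem of_primrec (hf : Primrec f) : TotalRecursiveIn O f := of_computable hf.to_comp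

theorem comp (hf : TotalRecursiveIn O f) (hg : TotalRecursiveIn O g) :
    TotalRecursiveIn O fun n => f (g n) :=
  (Nat.RecursiveIn.comp hf hg).of_eq fun _ => Part.bind_some _ _

theorem pair (hf : TotalRecursiveIn O f) (hg : TotalRecursiveIn O g) :
    TotalRecursiveIn O fun n => Nat.pair (f n) (g n) :=
  (Nat.RecursiveIn.pair hf hg).of_eq fun _ => by simp [Seq.seq]

theorem map₂ {F : ℕ → ℕ → ℕ} (hF : Primrec₂ F) (hf : TotalRecursiveIn O f)
    (hg : TotalRecursiveIn O g) : TotalRecursiveIn O fun n => F (f n) (g n) := by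
  have h : TotalRecursiveIn O fun n => F n.unpair.1 n.unpair.2 :=
    of_primrec (hF.comp (Primrec.fst.comp Primrec.unpair) (Primrec.snd.comp Primrec.unpair))
  simpa using h.comp (hf.pair hg)

theorem find (hf : TotalRecursiveIn O f) (h : ∀ a, f (Nat.pair a (g a)) = 0)
    (h' : ∀ a, ∀ k < g a, f (Nat.pair a k) ≠ 0) : TotalRecursiveIn O g := by
  refine (Nat.RecursiveIn.rfind hf).of_eq fun a => Part.eq_some_iff.2 (Nat.mem_rfind.2 ⟨?_, ?_⟩)
  · simp [h a]
  · intro m hm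
    simp [h' a m hm]

/-- The characteristic function of a set, with values in `ℕ`. -/
noncomputable def _root_.UHFComp.indicator (X : Set ℕ) (n : ℕ) : ℕ :=
  open Classical in if n ∈ X then 1 else 0

theorem indicator_self (X : Set ℕ) : TotalRecursiveIn (charFun X) (indicator X) :=
  Nat.RecursiveIn.oracle _ rfl

theorem of_reducible {X Y : Set ℕ} {r : ℕ → ℕ} (hr : Primrec r)
    (h : ∀ n, r n ∈ Y ↔ n ∈ X) : TotalRecursiveIn (charFun Y) (indicator X) := by
  have h' : indicator X = fun n => indicator Y (r n) := by
    funext n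
    by_cases hn : n ∈ X
    · simp [indicator, hn, (h n).2 hn]
    · simp [indicator, hn, mt (h n).1 hn]
  rw [h']
  exact (indicator_self Y).comp (of_primrec hr)

theorem trans {X : Set ℕ} (h : TotalRecursiveIn O (indicator X))
    (hf : TotalRecursiveIn (charFun X) f) : TotalRecursiveIn O f :=
  Nat.RecursiveIn.subst hf fun g hg => by
    obtain rfl : g = charFun X := hg
    exact h

end TotalRecursiveIn

/-- A set is many-one reducible to its jump. -/
theorem indicator_recursiveIn_jump (X : Set ℕ) :
    TotalRecursiveIn (charFun (jump X)) (indicator X) := by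
  -- The test does not depend on the search variable: the search ends at once if `a ∈ X` and never
  -- otherwise, so its domain is `X`.
  have hg : Nat.RecursiveIn {charFun X} fun a =>
      Nat.rfind fun n => (fun m => decide (m = 0)) <$>
        (Part.some (1 - indicator X (Nat.pair a n).unpair.1) : Part ℕ) :=
    Nat.RecursiveIn.rfind (TotalRecursiveIn.map₂ Primrec.nat_sub
      (TotalRecursiveIn.of_primrec (Primrec.const 1))
      ((TotalRecursiveIn.indicator_self X).comp
        (TotalRecursiveIn.of_primrec (Primrec.fst.comp Primrec.unpair))))
  obtain ⟨r, hr, h⟩ := exists_primrec_mem_jump hg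
  refine TotalRecursiveIn.of_reducible hr fun n => (h n).trans ?_
  rw [Part.dom_iff_mem]
  by_cases hn : n ∈ X
  · refine ⟨fun _ => hn, fun _ => ⟨0, Nat.mem_rfind.2 ⟨?_, fun h => absurd h (Nat.not_lt_zero _)⟩⟩⟩
    simp [indicator, hn]
  · refine ⟨fun ⟨s, hs⟩ => ?_, fun h => absurd h hn⟩
    have := (Nat.mem_rfind.1 hs).1
    simp [indicator, hn] at this

/-- The set of natural numbers satisfying an existential formula with primitive recursive matrix
is many-one reducible to `∅'`. -/
theorem exists_primrec_mem_jump_empty {Q : ℕ → ℕ → Prop} (hQ : PrimrecRel Q) :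
    ∃ r : ℕ → ℕ, Primrec r ∧ ∀ n, r n ∈ jump ∅ ↔ ∃ s, Q n s := by
  classical
  have hg : Partrec fun a : ℕ => Nat.rfind fun n : ℕ => (Part.some (decide (Q a n)) : Part Bool) :=
    Partrec.rfind (show Primrec₂ fun (a : ℕ) (n : ℕ) => decide (Q a n) from
      hQ.decide).to_comp.partrec
  obtain ⟨r, hr, h⟩ := exists_primrec_mem_jump (X := ∅) (Partrec.nat_iff.1 hg).recursiveIn
  refine ⟨r, hr, fun n => (h n).trans ?_⟩
  rw [Part.dom_iff_mem]
  constructor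
  · rintro ⟨s, hs⟩
    exact ⟨s, by simpa using (Nat.mem_rfind.1 hs).1⟩
  · intro hs
    refine ⟨Nat.find hs, Nat.mem_rfind.2 ⟨?_, fun {k} hk => ?_⟩⟩
    · simpa using Nat.find_spec hs
    · simpa using Nat.find_min hs hk

/-! ### Cardinalities of computably enumerable sets -/

/-- The number of elements of `W e` below `j` that are enumerated within `j` steps. -/
def stageCard (j e : ℕ) : ℕ := Nat.count (HaltsIn j (ofNat Code e)) j

theorem primrec_stageCard : Primrec₂ stageCard :=
  primrec_count (R := fun (p : ℕ × ℕ) m => HaltsIn p.1 (ofNat Code p.2) m)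
    (primrecPred_haltsIn (Primrec.fst.comp Primrec.fst)
      ((Primrec.ofNat _).comp (Primrec.snd.comp Primrec.fst)) Primrec.snd) Primrec.fst

theorem stageCard_mono {j j' : ℕ} (h : j ≤ j') (e : ℕ) : stageCard j e ≤ stageCard j' e :=
  (Nat.count_mono_left fun _ _ hm => HaltsIn.mono h hm).trans (Nat.count_monotone _ h)

/-- This is the Σ₁ form of `k < |W_e|`: finitely many elements have all appeared by some stage. -/
theorem lt_encard_W_iff {k e : ℕ} : (k : ℕ∞) < (W e).encard ↔ ∃ j, k < stageCard j e := by
  constructor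
  · intro hk
    obtain ⟨t, htW, ht⟩ := Set.exists_subset_encard_eq (Order.add_one_le_of_lt hk)
    have hfin : t.Finite := Set.finite_of_encard_eq_coe (k := k + 1) (by exact_mod_cast ht)
    lift t to Finset ℕ using hfin
    choose! s hs using fun m (hm : m ∈ t) => mem_W_iff.1 (htW hm)
    -- The stage limits both the running time and the size of the counted elements, so it must
    -- dominate both.
    refine ⟨max (t.sup s) (t.sup id + 1), ?_⟩
    rw [stageCard, Nat.count_eq_card_filter_range]
    have hcard : t.card = k + 1 := by
      rw [Set.encard_coe_eq_coe_finsetCard] at ht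
      exact_mod_cast ht
    refine lt_of_lt_of_le (by omega : k < t.card) (Finset.card_le_card fun m hm => ?_)
    rw [Finset.mem_filter, Finset.mem_range]
    refine ⟨lt_of_lt_of_le (Nat.lt_succ_of_le (Finset.le_sup (f := id) hm)) (le_max_right _ _), ?_⟩
    exact (hs m hm).mono ((Finset.le_sup hm).trans (le_max_left _ _))
  · rintro ⟨j, hj⟩
    rw [stageCard, Nat.count_eq_card_filter_range] at hj
    refine lt_of_lt_of_le (Nat.cast_lt.2 hj) ?_
    rw [← Set.encard_coe_eq_coe_finsetCard]
    refine Set.encard_le_encard fun m hm => mem_W_iff.2 ⟨j, ?_⟩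
    simpa using (Finset.mem_filter.1 hm).2

theorem iSup_stageCard (e : ℕ) : ⨆ j, (stageCard j e : ℕ∞) = (W e).encard := by
  refine le_antisymm (iSup_le fun j => ?_) ?_
  · by_contra! hlt
    obtain ⟨n, hn⟩ := ENat.ne_top_iff_exists.1 hlt.ne_top
    rw [← hn, Nat.cast_lt] at hlt
    exact absurd (lt_encard_W_iff.2 ⟨j, hlt⟩) (by rw [← hn]; exact lt_irrefl _)
  · by_contra! hlt
    obtain ⟨n, hn⟩ := ENat.ne_top_iff_exists.1 hlt.ne_top
    rw [← hn] at hlt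
    obtain ⟨j, hj⟩ := lt_encard_W_iff.1 hlt
    have := le_iSup (fun j => (stageCard j e : ℕ∞)) j
    rw [← hn, Nat.cast_le] at this
    omega

theorem tendsto_stageCard (e : ℕ) :
    Tendsto (fun j => (stageCard j e : ℕ∞)) atTop (𝓝 (W e).encard) := by
  rw [← iSup_stageCard]
  exact tendsto_atTop_iSup fun j j' h => Nat.cast_le.2 (stageCard_mono h e)

/-- The shift by one leaves the code 0 for `∞`, so a code vanishes exactly for an infinite
cardinality. -/
theorem encode_natCast (n : ℕ) : encode (n : ℕ∞) = n + 1 := rfl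

theorem encode_top : encode (⊤ : ℕ∞) = 0 := rfl

/-- The code of the cardinality of `W e`. -/
noncomputable def cardCode (e : ℕ) : ℕ := encode (W e).encard

theorem cardCode_eq_zero_iff {e : ℕ} : cardCode e = 0 ↔ (W e).Infinite := by
  rw [← Set.encard_eq_top_iff, cardCode]
  rcases eq_or_ne (W e).encard ⊤ with h | h
  · simp [h, encode_top]
  · obtain ⟨n, hn⟩ := ENat.ne_top_iff_exists.1 h
    simp [← hn, encode_natCast]

/-- One jump decides `k < |W_e|`, the second decides whether `W_e` is finite, and in the finite case
a terminating search finds the cardinality. -/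
theorem cardCode_recursiveIn : TotalRecursiveIn (charFun (jump (jump ∅))) cardCode := by
  obtain ⟨r, hr, hrj⟩ := exists_primrec_mem_jump_empty (Q := fun p j => p.unpair.2 <
    stageCard j p.unpair.1) (Primrec.nat_lt.comp (Primrec.snd.comp (Primrec.unpair.comp Primrec.fst))
      (primrec_stageCard.comp Primrec.snd (Primrec.fst.comp (Primrec.unpair.comp Primrec.fst))))
  have hrj' : ∀ e k, r (Nat.pair e k) ∈ jump ∅ ↔ (k : ℕ∞) < (W e).encard := by
    intro e k
    rw [hrj, lt_encard_W_iff, Nat.unpair_pair]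
  have hG : TotalRecursiveIn (charFun (jump ∅)) fun p => indicator (jump ∅) (r p) :=
    (TotalRecursiveIn.indicator_self _).comp (TotalRecursiveIn.of_primrec hr)
  -- Relative to `∅'`, the search for the first `k` with `|W_e| ≤ k` halts exactly when `W_e` is
  -- finite.
  have hfin : Nat.RecursiveIn {charFun (jump ∅)} fun a => Nat.rfind fun n =>
      (fun m => decide (m = 0)) <$> (Part.some (indicator (jump ∅) (r (Nat.pair a n))) : Part ℕ) :=
    Nat.RecursiveIn.rfind hG
  obtain ⟨f, hf, hfj⟩ := exists_primrec_mem_jump hfin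
  have hfj' : ∀ e, f e ∈ jump (jump ∅) ↔ (W e).Finite := by
    intro e
    rw [hfj, Part.dom_iff_mem]
    constructor
    · rintro ⟨k, hk⟩
      have hk' := (Nat.mem_rfind.1 hk).1
      have : r (Nat.pair e k) ∉ jump ∅ := by
        intro hmem
        simp [indicator, hmem] at hk'
      rw [hrj', not_lt] at this
      exact Set.finite_of_encard_le_coe this
    · intro hW
      obtain ⟨n, hn⟩ := ENat.ne_top_iff_exists.1 (Set.encard_ne_top_iff.2 hW)
      refine ⟨n, Nat.mem_rfind.2 ⟨?_, fun {m} hm => ?_⟩⟩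
      · have : r (Nat.pair e n) ∉ jump ∅ := by simp [hrj', ← hn]
        simp [indicator, this]
      · have : r (Nat.pair e m) ∈ jump ∅ := by simp [hrj', ← hn, hm]
        simp [indicator, this]
  have hF : TotalRecursiveIn (charFun (jump (jump ∅))) fun e => indicator (jump (jump ∅)) (f e) :=
    (TotalRecursiveIn.indicator_self _).comp (TotalRecursiveIn.of_primrec hf)
  -- The first factor vanishes for infinite `W_e`, so the search for a zero is total: it returns 0
  -- there and `|W_e|` otherwise.
  have htest : TotalRecursiveIn (charFun (jump (jump ∅))) fun p =>
      indicator (jump (jump ∅)) (f p.unpair.1) * indicator (jump ∅) (r p) :=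
    TotalRecursiveIn.map₂ Primrec.nat_mul
      (hF.comp (TotalRecursiveIn.of_primrec (Primrec.fst.comp Primrec.unpair)))
      ((indicator_recursiveIn_jump (jump ∅)).trans hG)
  have hpred : TotalRecursiveIn (charFun (jump (jump ∅))) fun e => cardCode e - 1 := by
    refine htest.find (fun e => ?_) fun e k hk => ?_
    · by_cases hW : (W e).Finite
      · obtain ⟨n, hn⟩ := ENat.ne_top_iff_exists.1 (Set.encard_ne_top_iff.2 hW)
        have : r (Nat.pair e (cardCode e - 1)) ∉ jump ∅ := by
          simp [hrj', cardCode, ← hn, encode_natCast]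
        simp [indicator, this]
      · have : f e ∉ jump (jump ∅) := by rwa [hfj']
        simp [indicator, this]
    · have hne : cardCode e ≠ 0 := by omega
      have hW : (W e).Finite := by rwa [Ne, cardCode_eq_zero_iff, Set.not_infinite] at hne
      obtain ⟨n, hn⟩ := ENat.ne_top_iff_exists.1 (Set.encard_ne_top_iff.2 hW)
      rw [cardCode, ← hn, encode_natCast] at hk
      have h₁ : f e ∈ jump (jump ∅) := (hfj' e).2 hW
      have h₂ : r (Nat.pair e k) ∈ jump ∅ := by
        rw [hrj', ← hn]
        exact_mod_cast (by omega : k < n)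
      simp [indicator, h₁, h₂]
  -- The indicator restores the code 0 of `∞`; for finite `W_e` the successor restores the shift.
  have h : cardCode = fun e => indicator (jump (jump ∅)) (f e) * (cardCode e - 1 + 1) := by
    funext e
    by_cases hW : (W e).Finite
    · have hne : cardCode e ≠ 0 := by rwa [Ne, cardCode_eq_zero_iff, Set.not_infinite]
      simp only [indicator, (hfj' e).2 hW, if_true]
      omega
    · have h0 : cardCode e = 0 := cardCode_eq_zero_iff.2 hW
      have : f e ∉ jump (jump ∅) := by rwa [hfj']
      simp [indicator, this, h0]
  rw [h]
  exact TotalRecursiveIn.map₂ Primrec.nat_mul hF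
    ((TotalRecursiveIn.of_primrec Primrec.succ).comp hpred)

/-! ### Supernatural numbers given by the cardinalities of computably enumerable sets -/

/-- The supernatural number `p_e ↦ |W_e|`. -/
noncomputable def cardSupernatural : Supernatural := fun p => (W (Nat.count Nat.Prime p)).encard

theorem count_nthPrime (e : ℕ) : Nat.count Nat.Prime (nthPrime e : ℕ) = e :=
  Nat.count_nth_of_infinite Nat.infinite_setOfPred_prime e

theorem cardSupernatural_nthPrime (e : ℕ) : cardSupernatural (nthPrime e) = (W e).encard := by
  rw [cardSupernatural, count_nthPrime]

theorem primrec_count_prime : Primrec (Nat.count Nat.Prime) :=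
  primrec_count (R := fun (_ : ℕ) n => Nat.Prime n) (primrecPred_prime.comp Primrec.snd) Primrec.id

/-- Search for the unique prime with exactly `e` primes below it. -/
theorem computable_nthPrime : Computable fun e => (nthPrime e : ℕ) := by
  obtain ⟨f, hf, h⟩ := exists_computable_choice
    (R := fun e p => Nat.Prime p ∧ Nat.count Nat.Prime p = e)
    (PrimrecPred.and (primrecPred_prime.comp Primrec.snd)
      (Primrec.eq.comp (primrec_count_prime.comp Primrec.snd) Primrec.fst))
    fun e => ⟨nthPrime e, (nthPrime e).2, count_nthPrime e⟩
  refine hf.of_eq fun e => ?_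
  obtain ⟨h₁, h₂⟩ := h e
  rw [← h₂]
  simp only [nthPrime, h₂]
  conv_rhs => rw [← h₂]
  exact (Nat.nth_count h₁).symm

/-- The stage approximations of `cardSupernatural`. -/
def stageApprox (j p : ℕ) : ℕ := stageCard j (Nat.count Nat.Prime p)

theorem primrec_stageApprox : Primrec₂ stageApprox :=
  primrec_stageCard.comp Primrec.fst (primrec_count_prime.comp Primrec.snd)

theorem stageApprox_mono {j j' : ℕ} (h : j ≤ j') (p : ℕ) : stageApprox j p ≤ stageApprox j' p :=
  stageCard_mono h _

theorem primrec_primes_val : Primrec fun p : Nat.Primes => (p : ℕ) :=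
  Primrec.subtype_val (hp := primrecPred_prime)

theorem lowerSemicomputable_cardSupernatural : LowerSemicomputable cardSupernatural :=
  ⟨fun j p => stageApprox j p,
    (primrec_stageApprox.comp Primrec.fst (primrec_primes_val.comp Primrec.snd)).to_comp,
    fun j p => stageApprox_mono (Nat.le_succ j) p, fun _ => tendsto_stageCard _⟩

/-- The additional 1 comes from the `Option` in `onCodes`; the value 0 is left for numbers that code
no prime. -/
theorem onCodes_cardSupernatural (n : ℕ) : onCodes cardSupernatural n =
    if n.Prime then cardCode (Nat.count Nat.Prime n) + 1 else 0 := by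
  split_ifs with hn
  · have h : (decode n : Option Nat.Primes) = some ⟨n, hn⟩ := encodek (⟨n, hn⟩ : Nat.Primes)
    rw [onCodes, h]
    rfl
  · have h : (decode n : Option Nat.Primes) = none := dif_neg hn
    rw [onCodes, h]
    rfl

theorem turingDegree_cardSupernatural : turingDegree cardSupernatural = zeroDoubleJump := by
  refine Quotient.sound ⟨?_, ?_⟩
  · refine RecursiveIn.iff_nat.2 (show TotalRecursiveIn _ (onCodes cardSupernatural) from ?_)
    have hind : Primrec fun n : ℕ => if n.Prime then 1 else 0 :=
      Primrec.ite primrecPred_prime (Primrec.const 1) (Primrec.const 0)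
    have h : onCodes cardSupernatural = fun n =>
        (if n.Prime then 1 else 0) * (cardCode (Nat.count Nat.Prime n) + 1) := by
      funext n
      rw [onCodes_cardSupernatural]
      split_ifs <;> simp
    rw [h]
    exact TotalRecursiveIn.map₂ Primrec.nat_mul (TotalRecursiveIn.of_primrec hind)
      ((TotalRecursiveIn.of_primrec Primrec.succ).comp
        (cardCode_recursiveIn.comp (TotalRecursiveIn.of_primrec primrec_count_prime)))
  · refine RecursiveIn.iff_nat.2 (show TotalRecursiveIn _ (indicator (jump (jump ∅))) from ?_)
    obtain ⟨f, hf, hfW⟩ := exists_primrec_finite_W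
    -- Subtracting 1 removes the `Option` shift and leaves `cardCode (f e)`, which is zero exactly
    -- for infinite `W (f e)`; the minimum with 1 turns it into the indicator of finiteness.
    have h : indicator (jump (jump ∅)) = fun e =>
        min 1 (onCodes cardSupernatural (nthPrime (f e)) - 1) := by
      funext e
      rw [onCodes_cardSupernatural, if_pos (nthPrime (f e)).2, count_nthPrime, Nat.add_sub_cancel]
      by_cases hW : (W (f e)).Finite
      · have hne : cardCode (f e) ≠ 0 := by rwa [Ne, cardCode_eq_zero_iff, Set.not_infinite]
        simp only [indicator, (hfW e).2 hW, if_true]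
        omega
      · have h0 : cardCode (f e) = 0 := cardCode_eq_zero_iff.2 hW
        have : e ∉ jump (jump ∅) := by rwa [hfW]
        simp [indicator, this, h0]
    rw [h]
    exact TotalRecursiveIn.map₂ Primrec.nat_min (TotalRecursiveIn.of_primrec (Primrec.const 1))
      (TotalRecursiveIn.map₂ Primrec.nat_sub (TotalRecursiveIn.comp
        (Nat.RecursiveIn.oracle _ rfl) (TotalRecursiveIn.of_computable
          (computable_nthPrime.comp hf.to_comp)))
        (TotalRecursiveIn.of_primrec (Primrec.const 1)))

theorem computable_onCodes {α β : Type} [Primcodable α] [Primcodable β] {f : α → β}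
    (hf : Computable f) : Computable (onCodes f) :=
  Computable.encode.comp (Computable.option_map Computable.decode (hf.comp Computable.snd))

/-- A computable value would decide whether a program has finite domain. Rice's theorem forbids
this: the nowhere defined function has finite domain and the constant zero function does not. -/
theorem not_computable_cardSupernatural : ¬ Computable cardSupernatural := by
  classical
  intro h
  have hval : ∀ c : Code, onCodes cardSupernatural (nthPrime (encode c)) ≠ 1 ↔
      {n | (c.eval n).Dom}.Finite := by
    intro c
    rw [onCodes_cardSupernatural, if_pos (nthPrime _).2, count_nthPrime, Ne, Nat.add_eq_right,
      cardCode_eq_zero_iff, Set.not_infinite, W, ofNat_encode]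
  have hc : Computable fun c : Code => onCodes cardSupernatural (nthPrime (encode c)) :=
    (computable_onCodes h).comp (computable_nthPrime.comp Computable.encode)
  have hP : ComputablePred fun c : Code => c.eval ∈ {f : ℕ →. ℕ | {n | (f n).Dom}.Finite} := by
    refine ⟨inferInstance, ((PrimrecPred.not (Primrec.eq.comp Primrec.id
      (Primrec.const 1))).decide.to_comp.comp hc).of_eq fun c => ?_⟩
    exact decide_eq_decide.2 (hval c)
  have hnone : {n | ((fun _ => Part.none : ℕ →. ℕ) n).Dom}.Finite :=
    Set.finite_empty.subset fun n hn => hn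
  have hzero : {n | ((pure 0 : ℕ →. ℕ) n).Dom}.Finite :=
    ComputablePred.rice {f : ℕ →. ℕ | {n | (f n).Dom}.Finite} hP Nat.Partrec.none Nat.Partrec.zero
      hnone
  exact Set.infinite_univ (hzero.subset fun n _ => trivial)

end UHFComp

/-! ### Traces, and invariance of the supernatural number. -/

namespace UHFComp

/-! ### Matrices with the operator norm -/

section Matrix
open scoped Matrix.Norms.L2Operator

theorem norm_entry_le {n : ℕ} (x : Matrix (Fin n) (Fin n) ℂ) (i j : Fin n) : ‖x i j‖ ≤ ‖x‖ := by
  have h := x.l2_opNorm_mulVec (PiLp.single 2 j 1)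
  rw [PiLp.norm_single, norm_one, mul_one] at h
  refine le_trans ?_ h
  have h' := PiLp.norm_apply_le
    ((EuclideanSpace.equiv (Fin n) ℂ).symm (x.mulVec (PiLp.single 2 j (1 : ℂ) : EuclideanSpace ℂ (Fin n)))) i
  simpa using h'

theorem norm_trace_le {n : ℕ} (x : Matrix (Fin n) (Fin n) ℂ) : ‖x.trace‖ ≤ n * ‖x‖ :=
  (norm_sum_le _ _).trans ((Finset.sum_le_sum fun i _ => norm_entry_le x i i).trans (by simp))

end Matrix

/-- A tracial functional on a matrix algebra is a multiple of the trace. -/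
theorem tracial_apply {n : ℕ} (τ : Matrix (Fin n) (Fin n) ℂ →ₗ[ℂ] ℂ)
    (hτ : ∀ x y, τ (x * y) = τ (y * x)) (x : Matrix (Fin n) (Fin n) ℂ) :
    (n : ℂ) * τ x = τ 1 * x.trace := by
  have hoff : ∀ i j, i ≠ j → τ (Matrix.single i j 1) = 0 := by
    intro i j hij
    have h := hτ (Matrix.single i i 1) (Matrix.single i j 1)
    rwa [Matrix.single_mul_single_same, Matrix.single_mul_single_of_ne _ _ _ _ hij.symm,
      map_zero, mul_one] at h
  have hdiag : ∀ i j, τ (Matrix.single i i 1) = τ (Matrix.single j j 1) := by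
    intro i j
    have h := hτ (Matrix.single i j 1) (Matrix.single j i 1)
    rwa [Matrix.single_mul_single_same, Matrix.single_mul_single_same, mul_one] at h
  have hx : ∀ (y : Matrix (Fin n) (Fin n) ℂ) (k : Fin n),
      τ y = τ (Matrix.single k k 1) * y.trace := by
    intro y k
    conv_lhs => rw [Matrix.matrix_eq_sum_single y]
    simp only [map_sum]
    have : ∀ i j, τ (Matrix.single i j (y i j)) =
        if i = j then τ (Matrix.single k k 1) * y i j else 0 := by
      intro i j
      have hs : Matrix.single i j (y i j) = y i j • Matrix.single i j (1 : ℂ) := by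
        simp [Matrix.smul_single]
      rw [hs, map_smul]
      split_ifs with hij
      · subst hij
        rw [hdiag i k, smul_eq_mul, mul_comm]
      · rw [hoff i j hij, smul_zero]
    simp only [this, Finset.sum_ite_eq, Finset.mem_univ, if_true, Matrix.trace, Matrix.diag,
      Finset.mul_sum]
  rcases n with _ | n
  · simp [Matrix.trace]
  · rw [hx x 0, hx 1 0, Matrix.trace_one]
    simp
    ring

/-- The trace of an idempotent matrix is a natural number. -/
theorem exists_trace_eq_natCast {n : ℕ} {f : Matrix (Fin n) (Fin n) ℂ} (hf : f * f = f) :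
    ∃ r : ℕ, f.trace = r := by
  have h : IsIdempotentElem (Matrix.toLin' f) := by
    rw [IsIdempotentElem, Module.End.mul_eq_comp, ← Matrix.toLin'_mul, hf]
  have htr := (LinearMap.IsIdempotentElem.isProj_range _ h).trace
  rw [Matrix.trace_toLin'_eq] at htr
  exact ⟨_, htr⟩

/-! ### Idempotents in C⋆-algebras -/

/-- A self-adjoint element that is almost idempotent is close to an idempotent. -/
theorem exists_idempotent_near {B : Type*} [CStarAlgebra B] {b : B} (hb : IsSelfAdjoint b) {δ : ℝ}
    (hδ : δ < 1 / 4) (h : ‖b * b - b‖ ≤ δ) : ∃ f : B, f * f = f ∧ ‖f - b‖ ≤ 2 * δ := by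
  have hδ0 : 0 ≤ δ := (norm_nonneg _).trans h
  have hcfc : cfc (fun x : ℝ => x * x - x) b = b * b - b := by
    rw [cfc_sub (fun x : ℝ => x * x) (fun x : ℝ => x) b, cfc_mul (fun x : ℝ => x) (fun x : ℝ => x) b,
      cfc_id' ℝ b]
  have hspec : ∀ x ∈ spectrum ℝ b, |x * x - x| ≤ δ := by
    intro x hx
    have := norm_apply_le_norm_cfc (fun x : ℝ => x * x - x) b hx
    rw [hcfc] at this
    exact this.trans h
  have hne : ∀ x ∈ spectrum ℝ b, x ≠ 1 / 2 := by
    rintro x hx rfl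
    have := (abs_le.1 (hspec _ hx)).1
    linarith
  -- Since `δ < 1/4`, the point `1/2` is not in the spectrum, so this step function is continuous
  -- there and defines an idempotent by functional calculus.
  let χ : ℝ → ℝ := fun x => if 1 / 2 < x then 1 else 0
  have hχ : ContinuousOn χ (spectrum ℝ b) := by
    intro x hx
    rcases lt_or_gt_of_ne (hne x hx) with hlt | hgt
    · have : χ =ᶠ[𝓝 x] fun _ => 0 := by
        filter_upwards [Iio_mem_nhds hlt] with y hy
        exact if_neg (not_lt.2 (le_of_lt hy))
      exact (continuousAt_const.congr this.symm).continuousWithinAt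
    · have : χ =ᶠ[𝓝 x] fun _ => 1 := by
        filter_upwards [Ioi_mem_nhds hgt] with y hy
        exact if_pos hy
      exact (continuousAt_const.congr this.symm).continuousWithinAt
  refine ⟨cfc χ b, ?_, ?_⟩
  · rw [← cfc_mul χ χ b]
    congr 1
    funext x
    by_cases hx : 1 / 2 < x <;> simp [χ]
  · have : cfc χ b - b = cfc (fun x => χ x - x) b := by
      rw [cfc_sub χ (fun x : ℝ => x) b, cfc_id' ℝ b]
    rw [this]
    -- On either side of `1/2`, one of the factors of `x (1 - x)` has absolute value at least `1/2`;
    -- the other is `χ x - x` up to sign, hence at most `2δ` in absolute value.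
    refine norm_cfc_le (by positivity) fun x hx => ?_
    have h₁ := abs_le.1 (hspec x hx)
    rw [Real.norm_eq_abs, abs_le]
    by_cases hx2 : 1 / 2 < x
    · simp only [χ, hx2, if_true]
      constructor <;> nlinarith
    · simp only [χ, hx2, if_false]
      constructor <;> nlinarith

theorem norm_le_one_of_projection {A : Type*} [CStarAlgebra A] {e : A} (he : e * e = e)
    (hs : star e = e) : ‖e‖ ≤ 1 := by
  have h := CStarRing.norm_star_mul_self (x := e)
  rw [hs, he] at h
  nlinarith [norm_nonneg e]

/-- Idempotents that are close to each other have the same trace. -/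
theorem tracial_eq_of_near {A : Type*} [CStarAlgebra A] {τ : A →ₗ[ℂ] ℂ}
    (hτ : ∀ x y, τ (x * y) = τ (y * x)) {e f : A} (he : e * e = e) (hes : star e = e)
    (hf : f * f = f) (hef : ‖f - e‖ < 1 / 4) : τ e = τ f := by
  have he1 := norm_le_one_of_projection he hes
  have hf1 : ‖f‖ ≤ 5 / 4 := by
    have := norm_add_le (f - e) e
    rw [sub_add_cancel] at this
    linarith
  -- This element satisfies `z e = f e = f z`. It is within `(5/4 + 1)/4 < 1` of the identity, hence
  -- invertible, and conjugates `e` to `f`. No continuity of `τ` is required.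
  set z : A := f * e + (1 - f) * (1 - e) with hz
  have h1z : 1 - z = f * (f - e) + (e - f) * e := by
    have : f * (f - e) + (e - f) * e = f * f - f * e + (e * e - f * e) := by noncomm_ring
    rw [this, hf, he, hz]
    noncomm_ring
  have hlt : ‖1 - z‖ < 1 := by
    rw [h1z]
    have h₁ := norm_add_le (f * (f - e)) ((e - f) * e)
    have h₂ := norm_mul_le f (f - e)
    have h₃ := norm_mul_le (e - f) e
    rw [norm_sub_rev e f] at h₃
    nlinarith [norm_nonneg (f - e), norm_nonneg f, norm_nonneg e]
  have hunit : IsUnit z := by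
    have := (Units.oneSub (1 - z) hlt).isUnit
    rwa [Units.val_oneSub, sub_sub_cancel] at this
  obtain ⟨u, hu⟩ := hunit
  have hze : (u : A) * e = f * u := by
    rw [hu, hz]
    have h₁ : (f * e + (1 - f) * (1 - e)) * e = f * (e * e) + (1 - f) * (e - e * e) := by
      noncomm_ring
    have h₂ : f * (f * e + (1 - f) * (1 - e)) = f * f * e + (f - f * f) * (1 - e) := by
      noncomm_ring
    rw [h₁, h₂, he, hf]
    simp
  calc τ e = τ ((↑u⁻¹ : A) * (u * e)) := by rw [Units.inv_mul_cancel_left]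
    _ = τ ((↑u⁻¹ : A) * (f * u)) := by rw [hze]
    _ = τ (f * u * (↑u⁻¹ : A)) := hτ _ _
    _ = τ f := by rw [Units.mul_inv_cancel_right]

/-! ### The supernatural number of a UHF algebra -/

namespace UHFLimit

variable {A : Type} [CStarAlgebra A] (S : UHFLimit A)

theorem exists_conn {k l : ℕ} (h : k ≤ l) :
    ∃ ψ : Matrix (Fin (S.n k)) (Fin (S.n k)) ℂ →⋆ₐ[ℂ] Matrix (Fin (S.n l)) (Fin (S.n l)) ℂ,
      ∀ x, S.incl l (ψ x) = S.incl k x := by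
  induction l, h using Nat.le_induction with
  | base => exact ⟨StarAlgHom.id ℂ _, fun x => rfl⟩
  | succ l hl ih =>
    obtain ⟨ψ, hψ⟩ := ih
    exact ⟨(S.conn l).comp ψ, fun x => by rw [StarAlgHom.comp_apply, S.incl_conn, hψ]⟩

/-- The trace pulled back along `ψ` is tracial, hence a multiple of the trace of `M_n`. -/
theorem trace_hom_eq_zero {n m : ℕ}
    (ψ : Matrix (Fin n) (Fin n) ℂ →⋆ₐ[ℂ] Matrix (Fin m) (Fin m) ℂ) (hn : 0 < n)
    {x : Matrix (Fin n) (Fin n) ℂ} (hx : x.trace = 0) : (ψ x).trace = 0 := by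
  have h := tracial_apply ((Matrix.traceLinearMap (Fin m) ℂ ℂ).comp ψ.toAlgHom.toLinearMap)
    (fun x y => by
      change (ψ (x * y)).trace = (ψ (y * x)).trace
      rw [map_mul, map_mul, Matrix.trace_mul_comm]) x
  rw [hx, mul_zero] at h
  exact (mul_eq_zero.1 h).resolve_left (by exact_mod_cast hn.ne')

open scoped Matrix.Norms.L2Operator in
theorem norm_incl (k : ℕ) (x : Matrix (Fin (S.n k)) (Fin (S.n k)) ℂ) : ‖S.incl k x‖ = ‖x‖ :=
  NonUnitalStarAlgHom.norm_map (S.incl k) (S.incl_injective k) x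

/-- The elements of trace zero of the matrix algebras. -/
def traceZero : Set A := {a | ∃ k x, x.trace = 0 ∧ S.incl k x = a}

/-- By density it suffices to treat commutators of matrices. Sums stay in the closure because two
trace-zero matrices can be moved to a common level, where their traces remain zero. -/
theorem span_commutator_subset_closure_traceZero :
    (Submodule.span ℂ {c : A | ∃ x y, c = x * y - y * x} : Set A) ⊆ closure S.traceZero := by
  intro c hc
  induction hc using Submodule.span_induction with
  | mem c hc =>
    obtain ⟨x, y, rfl⟩ := hc
    refine map_mem_closure₂ (f := fun x y : A => x * y - y * x) (by fun_prop)
      (S.dense x) (S.dense y) ?_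
    intro a ha b hb
    obtain ⟨k, x, rfl⟩ := Set.mem_iUnion.1 ha
    obtain ⟨l, y, rfl⟩ := Set.mem_iUnion.1 hb
    obtain ⟨ψ, hψ⟩ := S.exists_conn (le_max_left k l)
    obtain ⟨φ, hφ⟩ := S.exists_conn (le_max_right k l)
    refine ⟨max k l, ψ x * φ y - φ y * ψ x, ?_, ?_⟩
    · rw [Matrix.trace_sub, Matrix.trace_mul_comm, sub_self]
    · rw [map_sub, map_mul, map_mul, hψ, hφ]
  | zero => exact subset_closure ⟨0, 0, Matrix.trace_zero _ _, map_zero _⟩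
  | add a b _ _ ha hb =>
    refine map_mem_closure₂ (f := fun x y : A => x + y) (by fun_prop) ha hb ?_
    rintro _ ⟨k, x, hx, rfl⟩ _ ⟨l, y, hy, rfl⟩
    obtain ⟨ψ, hψ⟩ := S.exists_conn (le_max_left k l)
    obtain ⟨φ, hφ⟩ := S.exists_conn (le_max_right k l)
    refine ⟨max k l, ψ x + φ y, ?_, ?_⟩
    · rw [Matrix.trace_add, trace_hom_eq_zero ψ (S.n_pos k) hx,
        trace_hom_eq_zero φ (S.n_pos l) hy, add_zero]
    · rw [map_add, hψ, hφ]
  | smul r a _ ha =>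
    refine map_mem_closure (f := fun x : A => r • x) (by fun_prop) ha ?_
    rintro _ ⟨k, x, hx, rfl⟩
    exact ⟨k, r • x, by rw [Matrix.trace_smul, hx, smul_zero], map_smul _ _ _⟩

/-- A UHF algebra has a tracial functional. -/
theorem exists_tracial (S : UHFLimit A) : ∃ τ : A →ₗ[ℂ] ℂ, τ 1 = 1 ∧ ∀ x y, τ (x * y) = τ (y * x) := by
  -- If `x` has trace zero, then `n = |tr (1 - x)| ≤ n ‖1 - x‖`, so `x` cannot be within distance
  -- less than 1 of the identity.
  open scoped Matrix.Norms.L2Operator in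
  have h1 : (1 : A) ∉ Submodule.span ℂ {c : A | ∃ x y, c = x * y - y * x} := by
    intro h
    have h' := S.span_commutator_subset_closure_traceZero h
    obtain ⟨_, ⟨k, x, hx, rfl⟩, hlt⟩ := Metric.mem_closure_iff.1 h' 1 one_pos
    rw [dist_eq_norm, ← map_one (S.incl k), ← map_sub, norm_incl] at hlt
    have htr := norm_trace_le (1 - x)
    rw [Matrix.trace_sub, hx, sub_zero, Matrix.trace_one, Fintype.card_fin,
      Complex.norm_natCast] at htr
    have hn : (0 : ℝ) < S.n k := by exact_mod_cast S.n_pos k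
    nlinarith
  -- This separation is purely algebraic; the functional need not be bounded.
  obtain ⟨τ, hτ, hτ'⟩ := Submodule.exists_dual_map_eq_bot_of_notMem h1 inferInstance
  refine ⟨(τ 1)⁻¹ • τ, by simp [hτ], fun x y => ?_⟩
  have : τ (x * y - y * x) = 0 := by
    have hmem : τ (x * y - y * x) ∈
        (Submodule.span ℂ {c : A | ∃ x y, c = x * y - y * x}).map τ :=
      Submodule.mem_map_of_mem (Submodule.subset_span ⟨x, y, rfl⟩)
    rwa [hτ', Submodule.mem_bot] at hmem
  rw [map_sub, sub_eq_zero] at this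
  simp [this]

/-- Every projection is close to an idempotent of one of the matrix algebras. -/
theorem exists_idempotent_near_projection {e : A} (he : e * e = e) (hes : star e = e) :
    ∃ k, ∃ f : Matrix (Fin (S.n k)) (Fin (S.n k)) ℂ, f * f = f ∧ ‖S.incl k f - e‖ < 1 / 4 := by
  open scoped Matrix.Norms.L2Operator in
  have he1 := norm_le_one_of_projection he hes
  -- With error `1/64`, the symmetrized approximant satisfies `‖b² - b‖ ≤ 1/16`. The idempotent is
  -- then within `1/8` of `b`, hence within `1/8 + 1/64 < 1/4` of `e`.
  obtain ⟨_, hmem, hlt⟩ := Metric.mem_closure_iff.1 (S.dense e) (1 / 64) (by norm_num)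
  obtain ⟨k, b₀, rfl⟩ := Set.mem_iUnion.1 hmem
  rw [dist_eq_norm] at hlt
  let b : Matrix (Fin (S.n k)) (Fin (S.n k)) ℂ := (1 / 2 : ℂ) • (b₀ + star b₀)
  have hb : IsSelfAdjoint b := by
    simp [b, IsSelfAdjoint, add_comm]
  have hbe : ‖S.incl k b - e‖ ≤ 1 / 64 := by
    have : S.incl k b - e = (1 / 2 : ℂ) • ((S.incl k b₀ - e) + star (S.incl k b₀ - e)) := by
      rw [map_smul, map_add, map_star, star_sub, hes]
      module
    rw [this, norm_smul]
    have h₁ := norm_add_le (S.incl k b₀ - e) (star (S.incl k b₀ - e))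
    rw [norm_star, norm_sub_rev] at h₁
    have h₂ : ‖(1 / 2 : ℂ)‖ = 1 / 2 := by norm_num
    rw [h₂]
    linarith
  set d := S.incl k b - e with hd
  have hbd : S.incl k b = e + d := by rw [hd]; abel
  have hbb : ‖b * b - b‖ ≤ 1 / 16 := by
    rw [← S.norm_incl k, map_sub, map_mul, hbd]
    have h₀ : (e + d) * (e + d) - (e + d) = (e * e - e) + (e * d + d * e + d * d - d) := by
      noncomm_ring
    rw [h₀, he, sub_self, zero_add]
    have h₁ := norm_sub_le (e * d + d * e + d * d) d
    have h₂ := norm_add₃_le (a := e * d) (b := d * e) (c := d * d)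
    have h₃ := norm_mul_le e d
    have h₄ := norm_mul_le d e
    have h₅ := norm_mul_le d d
    nlinarith [norm_nonneg d, norm_nonneg e]
  obtain ⟨f, hf, hfb⟩ := exists_idempotent_near hb (by norm_num) hbb
  refine ⟨k, f, hf, ?_⟩
  have h₁ : S.incl k f - e = S.incl k (f - b) + d := by rw [map_sub, hd]; abel
  rw [h₁]
  have h₂ := norm_add_le (S.incl k (f - b)) d
  rw [S.norm_incl] at h₂
  linarith

/-- A matrix algebra that embeds unitally in a UHF algebra has size dividing the size of one of
the matrix algebras in any sequence that defines the UHF algebra. -/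
theorem exists_dvd {m : ℕ} (hm : 0 < m) (φ : Matrix (Fin m) (Fin m) ℂ →⋆ₐ[ℂ] A) :
    ∃ k, m ∣ S.n k := by
  obtain ⟨τ, hτ1, hτ⟩ := S.exists_tracial
  let i : Fin m := ⟨0, hm⟩
  -- Uniqueness of the trace: along any unital embedding, `τ` restricts to the normalized matrix
  -- trace.
  have htr : ∀ {n : ℕ} (ψ : Matrix (Fin n) (Fin n) ℂ →⋆ₐ[ℂ] A) (x : Matrix (Fin n) (Fin n) ℂ),
      (n : ℂ) * τ (ψ x) = x.trace := by
    intro n ψ x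
    have h := tracial_apply (τ.comp ψ.toAlgHom.toLinearMap) (fun x y => by
      change τ (ψ (x * y)) = τ (ψ (y * x))
      rw [map_mul ψ, map_mul ψ, hτ]) x
    change (n : ℂ) * τ (ψ x) = τ (ψ 1) * x.trace at h
    rwa [map_one, hτ1, one_mul] at h
  have hE : Matrix.single i i (1 : ℂ) * Matrix.single i i 1 = Matrix.single i i 1 := by simp
  have hEs : star (Matrix.single i i (1 : ℂ)) = Matrix.single i i 1 := by
    simp [Matrix.star_eq_conjTranspose]
  have he : φ (Matrix.single i i 1) * φ (Matrix.single i i 1) = φ (Matrix.single i i 1) := by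
    rw [← map_mul, hE]
  have hes : star (φ (Matrix.single i i 1)) = φ (Matrix.single i i 1) := by
    rw [← map_star, hEs]
  obtain ⟨k, f, hf, hlt⟩ := S.exists_idempotent_near_projection he hes
  obtain ⟨r, hr⟩ := exists_trace_eq_natCast hf
  have h₁ := tracial_eq_of_near hτ he hes (by rw [← map_mul, hf]) hlt
  have h₂ := htr φ (Matrix.single i i 1)
  have h₃ := htr (S.incl k) f
  rw [h₁, Matrix.trace_single_eq_same] at h₂
  rw [hr] at h₃
  refine ⟨k, r, ?_⟩
  -- The two evaluations of the same trace are `1/m` and `r/n_k`.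
  have : (S.n k : ℂ) = (m : ℂ) * r := by
    rw [← h₃, mul_left_comm, h₂, mul_one]
  exact_mod_cast this

/-- The supernatural number of a UHF algebra does not depend on the sequence of matrix algebras. -/
theorem supernatural_eq (S' : UHFLimit A) : S.supernatural = S'.supernatural := by
  have key : ∀ (S S' : UHFLimit A) (p : Nat.Primes), S.supernatural p ≤ S'.supernatural p := by
    intro S S' p
    refine iSup₂_le fun m hm => ?_
    obtain ⟨k, hk⟩ := hm
    obtain ⟨l, hl⟩ := S'.exists_dvd (S.n_pos k) (S.incl k)
    exact le_iSup₂_of_le m ⟨l, hk.trans hl⟩ le_rfl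
  exact funext fun p => le_antisymm (key S S' p) (key S' S p)

end UHFLimit
end UHFComp

/-! ### Concrete UHF algebras of operators on `ℓ²(ℕ)`. -/

namespace UHFComp

/-! ### Matrix algebras acting on `ℓ²(ℕ)` -/

section Operators

open scoped InnerProductSpace

/-- The Hilbert space `ℓ²(ℕ)`. -/
abbrev Ell2 : Type := lp (fun _ : ℕ => ℂ) 2

/-- The standard basis of `ℓ²(ℕ)`. -/
noncomputable def ell2Basis : HilbertBasis ℕ ℂ Ell2 := ⟨LinearIsometryEquiv.refl ℂ Ell2⟩

theorem inner_ell2Basis (r s : ℕ) : ⟪ell2Basis r, ell2Basis s⟫_ℂ = if r = s then 1 else 0 :=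
  orthonormal_iff_ite.1 ell2Basis.orthonormal r s

theorem ell2_ext {v w : Ell2} (h : ∀ r, ⟪ell2Basis r, v⟫_ℂ = ⟪ell2Basis r, w⟫_ℂ) : v = w := by
  apply ell2Basis.repr.injective
  ext r
  rw [HilbertBasis.repr_apply_apply, HilbertBasis.repr_apply_apply, h]

theorem clm_ext {S T : Ell2 →L[ℂ] Ell2} (h : ∀ r, S (ell2Basis r) = T (ell2Basis r)) : S = T := by
  refine ContinuousLinearMap.ext_on (s := Set.range ell2Basis) ?_ ?_
  · have := ell2Basis.dense_span
    rwa [← Submodule.dense_iff_topologicalClosure_eq_top] at this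
  · rintro _ ⟨r, rfl⟩
    exact h r

theorem injective_digit {n : ℕ} (i : Fin n) : Function.Injective fun q : ℕ => n * q + i := by
  intro q q' h
  have hn : 0 < n := i.pos
  exact Nat.eq_of_mul_eq_mul_left hn (Nat.add_right_cancel h)

/-- The isometry of `ℓ²(ℕ)` that sends the `q`-th basis vector to the basis vector with index
`n * q + i`. -/
noncomputable def digitIsometry {n : ℕ} (i : Fin n) : Ell2 →ₗᵢ[ℂ] Ell2 :=
  (ell2Basis.orthonormal.comp _ (injective_digit i)).orthogonalFamily.linearIsometry

theorem digitIsometry_apply {n : ℕ} (i : Fin n) (q : ℕ) :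
    digitIsometry i (ell2Basis q) = ell2Basis (n * q + i) := by
  have h : ell2Basis q = lp.single 2 q (1 : ℂ) :=
    (ell2Basis.repr_symm_single q).symm
  conv_lhs => rw [h, digitIsometry, OrthogonalFamily.linearIsometry_apply_single]
  simp

/-- `digitIsometry i` as a bounded operator. -/
noncomputable def digitOp {n : ℕ} (i : Fin n) : Ell2 →L[ℂ] Ell2 :=
  (digitIsometry i).toContinuousLinearMap

theorem digitOp_apply {n : ℕ} (i : Fin n) (q : ℕ) :
    digitOp i (ell2Basis q) = ell2Basis (n * q + i) := digitIsometry_apply i q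

theorem digit_inj {n : ℕ} {i j : Fin n} {q r : ℕ} : n * q + i = n * r + j ↔ q = r ∧ i = j := by
  constructor
  · intro h
    have h₁ : (n * q + i) / n = (n * r + j) / n := by rw [h]
    rw [Nat.mul_add_div i.pos, Nat.mul_add_div i.pos, Nat.div_eq_of_lt i.2,
      Nat.div_eq_of_lt j.2] at h₁
    obtain rfl : q = r := by simpa using h₁
    exact ⟨rfl, Fin.ext (by omega)⟩
  · rintro ⟨rfl, rfl⟩
    rfl

theorem star_digitOp_apply {n : ℕ} (i j : Fin n) (q : ℕ) :
    star (digitOp i) (ell2Basis (n * q + j)) = if i = j then ell2Basis q else 0 := by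
  refine ell2_ext fun r => ?_
  rw [ContinuousLinearMap.star_eq_adjoint, ContinuousLinearMap.adjoint_inner_right, digitOp_apply,
    inner_ell2Basis]
  by_cases hij : i = j
  · subst hij
    rw [if_pos rfl, inner_ell2Basis]
    simp only [digit_inj, and_true]
  · simp [digit_inj, hij]

/-- The action of `M_n` on `ℓ²(ℕ)` through the last digit in base `n`. -/
noncomputable def matrixOp {n : ℕ} (x : Matrix (Fin n) (Fin n) ℂ) : Ell2 →L[ℂ] Ell2 :=
  ∑ i, ∑ j, x i j • (digitOp i * star (digitOp j))

theorem matrixOp_apply {n : ℕ} (x : Matrix (Fin n) (Fin n) ℂ) (q : ℕ) (j : Fin n) :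
    matrixOp x (ell2Basis (n * q + j)) = ∑ i, x i j • ell2Basis (n * q + i) := by
  simp only [matrixOp, _root_.sum_apply, _root_.smul_apply,
    mul_apply_eq_comp, star_digitOp_apply]
  refine Finset.sum_congr rfl fun i _ => ?_
  rw [Finset.sum_eq_single j]
  · rw [if_pos rfl, digitOp_apply]
  · intro k _ hk
    rw [if_neg hk, map_zero, smul_zero]
  · intro h
    exact absurd (Finset.mem_univ j) h

theorem exists_digit {n : ℕ} (hn : 0 < n) (k : ℕ) : ∃ (q : ℕ) (j : Fin n), k = n * q + j :=
  ⟨k / n, ⟨k % n, Nat.mod_lt _ hn⟩, (Nat.div_add_mod k n).symm⟩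

theorem clm_ext_digit {n : ℕ} (hn : 0 < n) {S T : Ell2 →L[ℂ] Ell2}
    (h : ∀ (q : ℕ) (j : Fin n), S (ell2Basis (n * q + j)) = T (ell2Basis (n * q + j))) :
    S = T := by
  refine clm_ext fun k => ?_
  obtain ⟨q, j, rfl⟩ := exists_digit hn k
  exact h q j

/-- The action of `M_n` on `ℓ²(ℕ)`, as a unital ⋆-homomorphism. -/
noncomputable def matrixHom {n : ℕ} (hn : 0 < n) :
    Matrix (Fin n) (Fin n) ℂ →⋆ₐ[ℂ] (Ell2 →L[ℂ] Ell2) :=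
  { AlgHom.ofLinearMap
      { toFun := matrixOp
        map_add' := fun x y => by
          simp [matrixOp, add_smul, Finset.sum_add_distrib]
        map_smul' := fun c x => by
          simp [matrixOp, mul_smul, Finset.smul_sum] }
      (by
        refine clm_ext_digit hn fun q j => ?_
        change matrixOp 1 _ = _
        rw [matrixOp_apply]
        simp [Matrix.one_apply])
      (fun x y => by
        refine clm_ext_digit hn fun q j => ?_
        change matrixOp (x * y) _ = matrixOp x (matrixOp y _)
        rw [matrixOp_apply, matrixOp_apply, map_sum]
        simp only [map_smul, matrixOp_apply, Matrix.mul_apply, Finset.sum_smul, Finset.smul_sum,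
          smul_smul]
        rw [Finset.sum_comm]
        simp only [mul_comm]) with
    map_star' := fun x => by
      change matrixOp (star x) = star (matrixOp x)
      simp only [matrixOp, star_sum, star_smul, star_mul, star_star, Matrix.star_apply]
      rw [Finset.sum_comm] }

theorem matrixHom_apply {n : ℕ} (hn : 0 < n) (x : Matrix (Fin n) (Fin n) ℂ) (q : ℕ) (j : Fin n) :
    matrixHom hn x (ell2Basis (n * q + j)) = ∑ i, x i j • ell2Basis (n * q + i) :=
  matrixOp_apply x q j

theorem matrixHom_injective {n : ℕ} (hn : 0 < n) : Function.Injective (matrixHom hn) := by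
  rw [injective_iff_map_eq_zero]
  intro x hx
  ext i j
  have h := matrixHom_apply hn x 0 j
  rw [hx] at h
  have h' := congrArg (fun v => ⟪ell2Basis (n * 0 + i), v⟫_ℂ) h
  simp only [inner_sum, inner_smul_right, inner_ell2Basis, digit_inj] at h'
  simpa using h'.symm

/-- The embedding of `M_n` into `M_{mn}` along an identification of the index sets. -/
def ampHom {m n N : ℕ} (e : Fin m × Fin n ≃ Fin N) :
    Matrix (Fin n) (Fin n) ℂ →⋆ₐ[ℂ] Matrix (Fin N) (Fin N) ℂ :=
  { AlgHom.ofLinearMap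
      { toFun := fun x : Matrix (Fin n) (Fin n) ℂ => Matrix.of fun b c =>
          if (e.symm b).1 = (e.symm c).1 then x (e.symm b).2 (e.symm c).2 else 0
        map_add' := fun x y => by
          ext b c
          by_cases h : (e.symm b).1 = (e.symm c).1 <;> simp [h]
        map_smul' := fun r x => by
          ext b c
          by_cases h : (e.symm b).1 = (e.symm c).1 <;> simp [h] }
      (by
        ext b c
        obtain ⟨b, rfl⟩ := e.surjective b
        obtain ⟨c, rfl⟩ := e.surjective c
        simp only [LinearMap.coe_mk, AddHom.coe_mk, Matrix.of_apply, Equiv.symm_apply_apply,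
          Matrix.one_apply, e.injective.eq_iff, Prod.ext_iff]
        by_cases h₁ : b.1 = c.1 <;> simp [h₁])
      (fun x y => by
        ext b c
        obtain ⟨b, rfl⟩ := e.surjective b
        obtain ⟨c, rfl⟩ := e.surjective c
        simp only [LinearMap.coe_mk, AddHom.coe_mk, Matrix.of_apply, Matrix.mul_apply]
        rw [← e.sum_comp, Fintype.sum_prod_type]
        simp only [Equiv.symm_apply_apply]
        rw [Finset.sum_eq_single b.1]
        · by_cases h : b.1 = c.1 <;> simp [h]
        · intro r _ hr
          simp [Ne.symm hr]
        · intro h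
          exact absurd (Finset.mem_univ _) h) with
    map_star' := fun x => by
      ext b c
      change (if (e.symm b).1 = (e.symm c).1 then star (x (e.symm c).2 (e.symm b).2) else 0) =
        star (if (e.symm c).1 = (e.symm b).1 then x (e.symm c).2 (e.symm b).2 else 0)
      by_cases h : (e.symm b).1 = (e.symm c).1
      · rw [if_pos h, if_pos h.symm]
      · rw [if_neg h, if_neg (Ne.symm h), star_zero] }

theorem ampHom_apply {m n N : ℕ} (e : Fin m × Fin n ≃ Fin N) (x : Matrix (Fin n) (Fin n) ℂ)
    (b c : Fin m × Fin n) :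
    ampHom e x (e b) (e c) = if b.1 = c.1 then x b.2 c.2 else 0 := by
  change (if (e.symm (e b)).1 = (e.symm (e c)).1 then
    x (e.symm (e b)).2 (e.symm (e c)).2 else 0) = _
  rw [Equiv.symm_apply_apply, Equiv.symm_apply_apply]

/-- The identification of digits in base `N` with pairs of digits, where `n` divides `N`. -/
def digitEquiv {n N : ℕ} (h : n ∣ N) : Fin (N / n) × Fin n ≃ Fin N :=
  finProdFinEquiv.trans (finCongr (Nat.div_mul_cancel h))

theorem digitEquiv_val {n N : ℕ} (h : n ∣ N) (b : Fin (N / n) × Fin n) :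
    (digitEquiv h b : ℕ) = n * b.1 + b.2 := by
  simp [digitEquiv, add_comm]

/-- If the last base-`N` digit of a number is `n r + i` with `i < n`, then its last base-`n` digit
is `i`. Hence the images are nested in one operator algebra. -/
theorem matrixHom_ampHom {n N : ℕ} (hn : 0 < n) (hN : 0 < N) (h : n ∣ N)
    (x : Matrix (Fin n) (Fin n) ℂ) :
    matrixHom hN (ampHom (digitEquiv h) x) = matrixHom hn x := by
  refine clm_ext_digit hN fun q c => ?_
  obtain ⟨⟨r, j⟩, rfl⟩ := (digitEquiv h).surjective c
  rw [matrixHom_apply, ← (digitEquiv h).sum_comp, Fintype.sum_prod_type]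
  have hval : ∀ (r : Fin (N / n)) (i : Fin n),
      N * q + (digitEquiv h (r, i) : ℕ) = n * (N / n * q + r) + i := by
    intro r i
    have hN' := Nat.mul_div_cancel' h
    rw [digitEquiv_val]
    rw [mul_add, ← mul_assoc, hN', add_assoc]
  simp only [ampHom_apply, hval]
  rw [matrixHom_apply, Finset.sum_eq_single r]
  · simp
  · intro s _ hs
    simp [hs]
  · intro h
    exact absurd (Finset.mem_univ _) h

end Operators

/-! ### UHF algebras with prescribed matrix sizes -/

/-- A sequence of matrix sizes, each of which divides the next. -/
structure SizeSequence where
  size : ℕ → ℕ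
  size_pos : ∀ k, 0 < size k
  size_dvd : ∀ k, size k ∣ size (k + 1)

namespace SizeSequence

variable (s : SizeSequence)

theorem dvd_of_le {k l : ℕ} (h : k ≤ l) : s.size k ∣ s.size l := by
  induction l, h using Nat.le_induction with
  | base => exact dvd_rfl
  | succ l _ ih => exact ih.trans (s.size_dvd l)

theorem range_mono :
    Monotone fun k => (matrixHom (s.size_pos k)).range := by
  rintro k l h _ ⟨x, rfl⟩
  exact ⟨ampHom (digitEquiv (s.dvd_of_le h)) x, matrixHom_ampHom _ _ _ x⟩

/-- The UHF algebra of a sequence of matrix sizes, as a concrete algebra of operators. -/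
noncomputable def algebra : StarSubalgebra ℂ (Ell2 →L[ℂ] Ell2) :=
  (⨆ k, (matrixHom (s.size_pos k)).range).topologicalClosure

theorem isClosed_algebra : IsClosed (s.algebra : Set (Ell2 →L[ℂ] Ell2)) :=
  StarSubalgebra.isClosed_topologicalClosure _

/-- The underlying type of `s.algebra`. -/
def Carrier : Type := s.algebra

noncomputable instance : CStarAlgebra s.Carrier :=
  StarSubalgebra.cstarAlgebra (h_closed := s.isClosed_algebra) s.algebra

/-- The inclusion of the matrix algebras. -/
noncomputable def incl (k : ℕ) :
    Matrix (Fin (s.size k)) (Fin (s.size k)) ℂ →⋆ₐ[ℂ] s.Carrier :=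
  (matrixHom (s.size_pos k)).codRestrict s.algebra fun x =>
    StarSubalgebra.le_topologicalClosure _
      ((le_iSup (fun k => (matrixHom (s.size_pos k)).range) k) ⟨x, rfl⟩)

theorem incl_ampHom {k l : ℕ} (h : k ≤ l) (x : Matrix (Fin (s.size k)) (Fin (s.size k)) ℂ) :
    s.incl l (ampHom (digitEquiv (s.dvd_of_le h)) x) = s.incl k x :=
  Subtype.ext (matrixHom_ampHom (s.size_pos k) (s.size_pos l) (s.dvd_of_le h) x)

theorem dense_range : Dense (⋃ k, Set.range (s.incl k)) := by
  intro a
  rw [Metric.mem_closure_iff]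
  intro ε hε
  obtain ⟨T, hT, hlt⟩ := Metric.mem_closure_iff.1 a.2 ε hε
  rw [SetLike.mem_coe, ← SetLike.mem_coe,
    StarSubalgebra.coe_iSup_of_directed s.range_mono.directed_le] at hT
  obtain ⟨k, x, rfl⟩ := Set.mem_iUnion.1 hT
  exact ⟨s.incl k x, Set.mem_iUnion.2 ⟨k, x, rfl⟩, hlt⟩

/-- The UHF algebra of a sequence of matrix sizes is the limit of the matrix algebras. -/
noncomputable def limit : UHFLimit s.Carrier where
  n := s.size
  n_pos := s.size_pos
  conn k := ampHom (digitEquiv (s.size_dvd k))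
  incl := s.incl
  incl_injective k _ _ h := matrixHom_injective (s.size_pos k) (congrArg Subtype.val h)
  incl_conn k x := s.incl_ampHom (Nat.le_succ k) x
  dense := s.dense_range

theorem isSupernaturalNumberOf {ε : Supernatural} (h : s.limit.supernatural = ε) :
    IsSupernaturalNumberOf ε s.Carrier :=
  ⟨⟨s.limit⟩, fun S => (S.supernatural_eq s.limit).trans h⟩

end SizeSequence
end UHFComp

/-! ### Operator norms from traces. -/

namespace UHFComp

/-! ### The norm of a matrix from traces of positive powers -/

section Norm
open scoped Matrix.Norms.L2Operator

/-- `x`, `x⋆ x`, `(x⋆ x)⋆ (x⋆ x)`, ... -/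
noncomputable def starSquare {n : ℕ} (x : Matrix (Fin n) (Fin n) ℂ) :
    ℕ → Matrix (Fin n) (Fin n) ℂ
  | 0 => x
  | j + 1 => star (starSquare x j) * starSquare x j

theorem norm_starSquare {n : ℕ} (x : Matrix (Fin n) (Fin n) ℂ) (j : ℕ) :
    ‖starSquare x j‖ = ‖x‖ ^ 2 ^ j := by
  induction j with
  | zero => simp [starSquare]
  | succ j ih => rw [starSquare, CStarRing.norm_star_mul_self, ih, ← pow_add, pow_succ, mul_two]

theorem norm_single_le {n : ℕ} (i j : Fin n) (c : ℂ) : ‖Matrix.single i j c‖ ≤ ‖c‖ := by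
  have h : star (Matrix.single i j c) * Matrix.single i j c =
      Matrix.diagonal (Pi.single j (star c * c)) := by
    rw [Matrix.star_eq_conjTranspose, Matrix.conjTranspose_single, Matrix.single_mul_single_same,
      Matrix.diagonal_single]
  have h' := CStarRing.norm_star_mul_self (x := Matrix.single i j c)
  rw [h, Matrix.l2_opNorm_diagonal] at h'
  have h'' : ‖(Pi.single j (star c * c) : Fin n → ℂ)‖ ≤ ‖c‖ * ‖c‖ := by
    refine (pi_norm_le_iff_of_nonneg (by positivity)).2 fun k => ?_
    by_cases hk : k = j
    · subst hk
      simp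
    · rw [Pi.single_eq_of_ne hk, norm_zero]
      positivity
  rw [h'] at h''
  exact abs_le_of_sq_le_sq' (by nlinarith) (norm_nonneg _) |>.2

theorem trace_star_mul_self_re {n : ℕ} (x : Matrix (Fin n) (Fin n) ℂ) :
    (star x * x).trace.re = ∑ j, ∑ i, ‖x i j‖ ^ 2 := by
  rw [Matrix.trace, Complex.re_sum]
  refine Finset.sum_congr rfl fun j _ => ?_
  rw [Matrix.diag_apply, Matrix.mul_apply, Complex.re_sum]
  refine Finset.sum_congr rfl fun i _ => ?_
  rw [Matrix.star_apply, Complex.star_def, ← Complex.normSq_eq_conj_mul_self, Complex.ofReal_re,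
    Complex.normSq_eq_norm_sq]

/-- Triangle inequality over the entries, then Cauchy–Schwarz. The crude factor `n²` is harmless,
since roots of high order will be taken. -/
theorem norm_sq_le_trace {n : ℕ} (x : Matrix (Fin n) (Fin n) ℂ) :
    ‖x‖ ^ 2 ≤ (n : ℝ) ^ 2 * (star x * x).trace.re := by
  have h₁ : ‖x‖ ≤ ∑ p : Fin n × Fin n, ‖x p.1 p.2‖ := by
    conv_lhs => rw [Matrix.matrix_eq_sum_single x]
    rw [Fintype.sum_prod_type]
    exact (norm_sum_le _ _).trans (Finset.sum_le_sum fun i _ =>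
      (norm_sum_le _ _).trans (Finset.sum_le_sum fun j _ => norm_single_le i j _))
  have h₂ := sq_sum_le_card_mul_sum_sq (s := (Finset.univ : Finset (Fin n × Fin n)))
    (f := fun p => ‖x p.1 p.2‖)
  rw [Finset.card_univ, Fintype.card_prod, Fintype.card_fin, Fintype.sum_prod_type,
    Fintype.sum_prod_type] at h₂
  rw [Fintype.sum_prod_type] at h₁
  rw [trace_star_mul_self_re, Finset.sum_comm]
  refine (pow_le_pow_left₀ (norm_nonneg _) h₁ 2).trans (h₂.trans (le_of_eq ?_))
  push_cast
  ring

theorem le_trace_starSquare {n : ℕ} (x : Matrix (Fin n) (Fin n) ℂ) (j : ℕ) :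
    ‖x‖ ^ 2 ^ (j + 1) ≤ (n : ℝ) ^ 2 * (starSquare x (j + 1)).trace.re := by
  have h := norm_sq_le_trace (starSquare x j)
  rwa [norm_starSquare, ← pow_mul, ← pow_succ] at h

theorem trace_starSquare_le {n : ℕ} (x : Matrix (Fin n) (Fin n) ℂ) (j : ℕ) :
    (starSquare x (j + 1)).trace.re ≤ n * ‖x‖ ^ 2 ^ (j + 1) := by
  rw [← norm_starSquare]
  exact (Complex.re_le_norm _).trans (norm_trace_le _)

end Norm

theorem exists_mul_pow_le {a b c : ℝ} (ha : 0 ≤ a) (hab : a < b) :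
    ∃ j : ℕ, c * a ^ 2 ^ (j + 1) ≤ b ^ 2 ^ (j + 1) := by
  have hb : 0 < b := lt_of_le_of_lt ha hab
  have h : Tendsto (fun j : ℕ => c * (a / b) ^ 2 ^ (j + 1)) atTop (𝓝 (c * 0)) := by
    refine Tendsto.const_mul c ((tendsto_pow_atTop_nhds_zero_of_lt_one (by positivity)
      ((div_lt_one hb).2 hab)).comp ?_)
    exact (tendsto_pow_atTop_atTop_of_one_lt one_lt_two).comp (tendsto_add_atTop_nat 1)
  rw [mul_zero] at h
  obtain ⟨j, hj⟩ := (h.eventually_le_const one_pos).exists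
  refine ⟨j, ?_⟩
  rw [div_pow, mul_div_assoc', div_le_one (by positivity)] at hj
  exact hj

/-- Raising the exponent multiplies the left side by `a ^ d` and the right by the larger `b ^ d`.
Having all large `j` lets two inequalities be met by the same `j`. -/
theorem exists_mul_pow_le_mono {a b c : ℝ} (ha : 0 ≤ a) (hab : a < b) :
    ∃ j₀ : ℕ, ∀ j ≥ j₀, c * a ^ 2 ^ (j + 1) ≤ b ^ 2 ^ (j + 1) := by
  have hb : 0 < b := lt_of_le_of_lt ha hab
  obtain ⟨j₀, h⟩ := exists_mul_pow_le (c := c) ha hab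
  refine ⟨j₀, fun j hj => ?_⟩
  have hle : 2 ^ (j₀ + 1) ≤ 2 ^ (j + 1) := Nat.pow_le_pow_right two_pos (by omega)
  obtain ⟨d, hd⟩ := Nat.exists_eq_add_of_le hle
  rw [hd, pow_add a (2 ^ (j₀ + 1)) d, pow_add b (2 ^ (j₀ + 1)) d, ← mul_assoc]
  exact mul_le_mul h (pow_le_pow_left₀ ha hab.le d) (by positivity)
    (by positivity)

/-- The bounds on traces of powers that certify that the norm is close to `m / G`. -/
def NormCertificate (n D G : ℕ) (t : ℕ → ℝ) (m j : ℕ) : Prop :=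
  n * ((m : ℝ) * D) ^ 2 ^ (j + 1) ≤ t j * (G : ℝ) ^ 2 ^ (j + 1) ∧
    (n : ℝ) ^ 2 * (t j * (G : ℝ) ^ 2 ^ (j + 1)) ≤ (((m : ℝ) + 2) * D) ^ 2 ^ (j + 1)

section Certificate

variable {n D G : ℕ} {t : ℕ → ℝ} {ν : ℝ}

/-- Combined with the trace bounds, taking roots of order `2 ^ (j + 1)` gives `m ≤ ν G ≤ m + 2`. -/
theorem NormCertificate.bounds (hn : 0 < n) (hD : 0 < D) (hG : 0 < G) (hν : 0 ≤ ν)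
    (h₁ : ∀ j, (D * ν) ^ 2 ^ (j + 1) ≤ (n : ℝ) ^ 2 * t j)
    (h₂ : ∀ j, t j ≤ n * (D * ν) ^ 2 ^ (j + 1)) {m j : ℕ} (h : NormCertificate n D G t m j) :
    |ν - (m : ℝ) / G| ≤ 2 / G := by
  have hn' : (0 : ℝ) < n := by exact_mod_cast hn
  have hD' : (0 : ℝ) < D := by exact_mod_cast hD
  have hG' : (0 : ℝ) < G := by exact_mod_cast hG
  have hE : 2 ^ (j + 1) ≠ 0 := by positivity
  have lower : (m : ℝ) * D ≤ D * ν * G := by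
    have : n * ((m : ℝ) * D) ^ 2 ^ (j + 1) ≤ n * (D * ν * G) ^ 2 ^ (j + 1) := by
      refine h.1.trans ?_
      rw [mul_pow (D * ν) (G : ℝ), ← mul_assoc]
      exact mul_le_mul_of_nonneg_right (h₂ j) (by positivity)
    exact le_of_pow_le_pow_left₀ hE (by positivity) (le_of_mul_le_mul_left this hn')
  have upper : D * ν * G ≤ ((m : ℝ) + 2) * D := by
    have : (D * ν * G) ^ 2 ^ (j + 1) ≤ (((m : ℝ) + 2) * D) ^ 2 ^ (j + 1) := by
      refine le_trans ?_ h.2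
      rw [mul_pow (D * ν) (G : ℝ), ← mul_assoc]
      exact mul_le_mul_of_nonneg_right (h₁ j) (by positivity)
    exact le_of_pow_le_pow_left₀ hE (by positivity) this
  have lower' : (m : ℝ) ≤ ν * G := by nlinarith
  have upper' : ν * G ≤ m + 2 := by nlinarith
  have hv : ν = ν * G / G := by field_simp
  rw [hv, ← sub_div, abs_div, abs_of_pos hG', div_le_div_iff_of_pos_right hG', abs_le]
  constructor <;> linarith

theorem NormCertificate.exists (hn : 0 < n) (hD : 0 < D) (hG : 0 < G) (hν : 0 ≤ ν)
    (h₁ : ∀ j, (D * ν) ^ 2 ^ (j + 1) ≤ (n : ℝ) ^ 2 * t j)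
    (h₂ : ∀ j, t j ≤ n * (D * ν) ^ 2 ^ (j + 1)) : ∃ m j, NormCertificate n D G t m j := by
  have hD' : (0 : ℝ) < D := by exact_mod_cast hD
  have hG' : (0 : ℝ) < G := by exact_mod_cast hG
  set z : ℝ := D * ν * G with hz
  have hz0 : 0 ≤ z := by positivity
  have hbase : 0 ≤ ν * G := by positivity
  have hfl := Nat.floor_le hbase
  have hfl' := Nat.lt_floor_add_one (ν * G)
  -- This choice gives the strict inequalities `m < ν G < m + 2` when `m ≠ 0`, and strictness
  -- absorbs the dimension factors for large `j`. The subtraction is truncated: for `m = 0` the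
  -- lower condition is just nonnegativity of the trace.
  set m := ⌊ν * G⌋₊ - 1 with hm
  have hupper : z < ((m : ℝ) + 2) * D := by
    have : (⌊ν * G⌋₊ : ℝ) ≤ m + 1 := by exact_mod_cast (by omega : ⌊ν * G⌋₊ ≤ m + 1)
    have h3 : ν * G < m + 2 := by linarith
    rw [hz]
    nlinarith
  have htj : ∀ j, t j * (G : ℝ) ^ 2 ^ (j + 1) ≤ n * z ^ 2 ^ (j + 1) := by
    intro j
    rw [hz, mul_pow (D * ν) (G : ℝ), ← mul_assoc]
    exact mul_le_mul_of_nonneg_right (h₂ j) (by positivity)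
  have htj' : ∀ j, z ^ 2 ^ (j + 1) ≤ (n : ℝ) ^ 2 * (t j * (G : ℝ) ^ 2 ^ (j + 1)) := by
    intro j
    rw [hz, mul_pow (D * ν) (G : ℝ), ← mul_assoc]
    exact mul_le_mul_of_nonneg_right (h₁ j) (by positivity)
  obtain ⟨j₁, hj₁⟩ := exists_mul_pow_le_mono (c := (n : ℝ) ^ 2 * n) hz0 hupper
  have hlow : ∃ j₂ : ℕ, ∀ j ≥ j₂,
      n * ((m : ℝ) * D) ^ 2 ^ (j + 1) ≤ t j * (G : ℝ) ^ 2 ^ (j + 1) := by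
    have hn' : (0 : ℝ) < n := by exact_mod_cast hn
    by_cases hm0 : m = 0
    · refine ⟨0, fun j _ => ?_⟩
      have h3 : 0 ≤ (n : ℝ) ^ 2 * (t j * (G : ℝ) ^ 2 ^ (j + 1)) :=
        le_trans (by positivity) (htj' j)
      have h4 : 0 ≤ t j * (G : ℝ) ^ 2 ^ (j + 1) := nonneg_of_mul_nonneg_right h3 (by positivity)
      simpa [hm0] using h4
    · have hlt : (m : ℝ) * D < z := by
        have : (m : ℝ) + 1 = ⌊ν * G⌋₊ := by exact_mod_cast (by omega : m + 1 = ⌊ν * G⌋₊)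
        rw [hz]
        nlinarith
      obtain ⟨j₂, hj₂⟩ := exists_mul_pow_le_mono (c := (n : ℝ) ^ 2 * n)
        (by positivity) hlt
      refine ⟨j₂, fun j hj => ?_⟩
      have h3 := (hj₂ j hj).trans (htj' j)
      rw [mul_assoc] at h3
      exact le_of_mul_le_mul_left h3 (by positivity)
  obtain ⟨j₂, hj₂⟩ := hlow
  refine ⟨m, max j₁ j₂, hj₂ _ (le_max_right _ _), ?_⟩
  refine le_trans ?_ (hj₁ _ (le_max_left _ _))
  rw [mul_assoc]
  exact mul_le_mul_of_nonneg_left (htj _) (by positivity)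

end Certificate
end UHFComp

/-! ### Exact arithmetic with matrix units, and the generators. -/

namespace UHFComp

/-! ### Matrices as lists of signed matrix units -/

/-- The matrix unit `E_{ab}` of `M_N`, which vanishes unless `a, b < N`. -/
def natUnit (N a b : ℕ) : Matrix (Fin N) (Fin N) ℂ :=
  Matrix.of fun i j => if (i : ℕ) = a ∧ (j : ℕ) = b then 1 else 0

theorem natUnit_apply (N a b : ℕ) (i j : Fin N) :
    natUnit N a b i j = if (i : ℕ) = a ∧ (j : ℕ) = b then 1 else 0 := rfl

theorem natUnit_mul (N a b c d : ℕ) :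
    natUnit N a b * natUnit N c d = if b = c ∧ c < N then natUnit N a d else 0 := by
  ext i j
  rw [Matrix.mul_apply]
  simp only [natUnit_apply]
  split_ifs with h
  · obtain ⟨rfl, hN⟩ := h
    rw [Finset.sum_eq_single ⟨b, hN⟩]
    · by_cases h₁ : (i : ℕ) = a <;> by_cases h₂ : (j : ℕ) = d <;> simp [natUnit_apply, h₁, h₂]
    · intro l _ hl
      have : (l : ℕ) ≠ b := fun h => hl (Fin.ext h)
      simp [this]
    · intro h
      exact absurd (Finset.mem_univ _) h
  · refine Finset.sum_eq_zero fun l _ => ?_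
    by_cases h₁ : (l : ℕ) = b
    · by_cases h₂ : (l : ℕ) = c
      · exact absurd ⟨h₁.symm.trans h₂, h₂ ▸ l.2⟩ h
      · simp [h₂]
    · simp [h₁]

theorem star_natUnit (N a b : ℕ) : star (natUnit N a b) = natUnit N b a := by
  ext i j
  rw [Matrix.star_apply, natUnit_apply, natUnit_apply]
  by_cases h₁ : (i : ℕ) = b <;> by_cases h₂ : (j : ℕ) = a <;> simp [h₁, h₂]

theorem trace_natUnit (N a b : ℕ) :
    (natUnit N a b).trace = if a = b ∧ b < N then 1 else 0 := by
  rw [Matrix.trace]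
  simp only [Matrix.diag_apply, natUnit_apply]
  split_ifs with h
  · obtain ⟨rfl, hN⟩ := h
    rw [Finset.sum_eq_single ⟨a, hN⟩]
    · simp
    · intro l _ hl
      have : (l : ℕ) ≠ a := fun h => hl (Fin.ext h)
      simp [this]
    · intro h
      exact absurd (Finset.mem_univ _) h
  · refine Finset.sum_eq_zero fun l _ => if_neg ?_
    rintro ⟨rfl, rfl⟩
    exact h ⟨rfl, l.2⟩

/-- The triple `(k, a, b)` stands for `i ^ k E_{ab}`. -/
abbrev Item : Type := ℕ × ℕ × ℕ

noncomputable def itemVal (N : ℕ) (u : Item) : Matrix (Fin N) (Fin N) ℂ :=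
  Complex.I ^ u.1 • natUnit N u.2.1 u.2.2

/-- A list of signed matrix units stands for its sum. -/
noncomputable def listVal (N : ℕ) (L : List Item) : Matrix (Fin N) (Fin N) ℂ :=
  (L.map (itemVal N)).sum

theorem listVal_nil (N : ℕ) : listVal N [] = 0 := rfl

theorem listVal_cons (N : ℕ) (u : Item) (L : List Item) :
    listVal N (u :: L) = itemVal N u + listVal N L := by
  simp [listVal]

theorem listVal_append (N : ℕ) (L M : List Item) :
    listVal N (L ++ M) = listVal N L + listVal N M := by
  simp [listVal]

theorem listVal_flatMap {α : Type*} (N : ℕ) (l : List α) (f : α → List Item) :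
    listVal N (l.flatMap f) = (l.map fun x => listVal N (f x)).sum := by
  induction l with
  | nil => rfl
  | cons x l ih => rw [List.flatMap_cons, listVal_append, ih, List.map_cons, List.sum_cons]

/-- The product of two signed matrix units. -/
def itemMul (N : ℕ) (u v : Item) : List Item :=
  if u.2.2 = v.2.1 ∧ v.2.1 < N then [(u.1 + v.1, u.2.1, v.2.2)] else []

theorem listVal_itemMul (N : ℕ) (u v : Item) :
    listVal N (itemMul N u v) = itemVal N u * itemVal N v := by
  rw [itemVal, itemVal, smul_mul_smul_comm, natUnit_mul, itemMul, ← pow_add]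
  split_ifs with h
  · simp [listVal, itemVal]
  · simp [listVal]

/-- The product of two lists of signed matrix units. -/
def listMul (N : ℕ) (L M : List Item) : List Item := L.flatMap fun u => M.flatMap (itemMul N u)

theorem listVal_mul (N : ℕ) (L M : List Item) :
    listVal N (listMul N L M) = listVal N L * listVal N M := by
  simp only [listMul, listVal_flatMap, listVal_itemMul, List.sum_map_mul_left,
    List.sum_map_mul_right]
  rfl

/-- The adjoint of a list of signed matrix units. -/
def listStar (L : List Item) : List Item := L.map fun u => (3 * u.1, u.2.2, u.2.1)

/-- The conjugate of `i` is `i³`, so conjugation triples the exponent. -/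
theorem star_itemVal (N : ℕ) (u : Item) : star (itemVal N u) = itemVal N (3 * u.1, u.2.2, u.2.1) := by
  rw [itemVal, itemVal, star_smul, star_natUnit, star_pow, pow_mul, Complex.I_pow_three]
  simp

theorem listVal_star (N : ℕ) (L : List Item) : listVal N (listStar L) = star (listVal N L) := by
  induction L with
  | nil => simp [listStar, listVal_nil]
  | cons u L ih =>
    rw [listVal_cons, star_add, star_itemVal, ← ih]
    exact listVal_cons _ _ _

/-- The number of items on the diagonal whose power of `i` has the residue `r` modulo `4`. -/
def diagCount (r N : ℕ) (L : List Item) : ℕ :=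
  (L.filter fun u => u.1 % 4 = r ∧ u.2.1 = u.2.2 ∧ u.2.2 < N).length

theorem re_I_pow (k : ℕ) : (Complex.I ^ k).re =
    (if k % 4 = 0 then 1 else 0) - (if k % 4 = 2 then 1 else 0) := by
  rw [Complex.I_pow_eq_pow_mod]
  have : k % 4 < 4 := Nat.mod_lt _ (by norm_num)
  interval_cases k % 4 <;> simp [Complex.I_pow_three]

theorem diagCount_cons (r N : ℕ) (u : Item) (L : List Item) : diagCount r N (u :: L) =
    (if u.1 % 4 = r ∧ u.2.1 = u.2.2 ∧ u.2.2 < N then 1 else 0) + diagCount r N L := by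
  rw [diagCount, diagCount, List.filter_cons]
  by_cases h : u.1 % 4 = r ∧ u.2.1 = u.2.2 ∧ u.2.2 < N
  · simp [h, add_comm]
  · rw [if_neg h, if_neg (by simpa using h), zero_add]

/-- Only diagonal items with the even powers of `i` have nonzero real part, so the trace is a
difference of two counts. -/
theorem re_trace_listVal (N : ℕ) (L : List Item) :
    (listVal N L).trace.re = (diagCount 0 N L : ℝ) - diagCount 2 N L := by
  induction L with
  | nil => simp [listVal_nil, diagCount]
  | cons u L ih =>
    rw [listVal_cons, Matrix.trace_add, Complex.add_re, ih, diagCount_cons, diagCount_cons, itemVal,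
      Matrix.trace_smul, trace_natUnit, smul_eq_mul]
    by_cases h : u.2.1 = u.2.2 ∧ u.2.2 < N
    · rw [if_pos h, mul_one, re_I_pow]
      simp only [h, and_true, and_self]
      push_cast
      ring
    · rw [if_neg h]
      simp [h]

/-- `starSquare` on lists of signed matrix units. -/
def starSquareList (N : ℕ) (L : List Item) : ℕ → List Item
  | 0 => L
  | j + 1 => listMul N (listStar (starSquareList N L j)) (starSquareList N L j)

theorem listVal_starSquareList (N : ℕ) (L : List Item) (j : ℕ) :
    listVal N (starSquareList N L j) = starSquare (listVal N L) j := by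
  induction j with
  | zero => rfl
  | succ j ih => rw [starSquareList, starSquare, listVal_mul, listVal_star, ih]

/-- The identity matrix as a list of matrix units. -/
def listOne (N : ℕ) : List Item := (List.range N).map fun q => (0, q, q)

theorem listVal_map_range (N m : ℕ) (f : ℕ → Item) :
    listVal N ((List.range m).map f) = ∑ q ∈ Finset.range m, itemVal N (f q) := by
  rw [listVal, List.map_map]
  rfl

theorem listVal_one (N : ℕ) : listVal N (listOne N) = 1 := by
  ext i j
  rw [listOne, listVal_map_range, Matrix.sum_apply, Matrix.one_apply]
  simp only [itemVal, pow_zero, one_smul, natUnit_apply]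
  rw [Finset.sum_eq_single (i : ℕ)]
  · simp [Fin.ext_iff, eq_comm]
  · intro q _ hq
    simp [Ne.symm hq]
  · intro h
    exact absurd (Finset.mem_range.2 i.2) h

/-- The product of a list of signed matrix units with a power of `i`. -/
def listRotate (k : ℕ) (L : List Item) : List Item := L.map fun u => (k + u.1, u.2)

theorem listVal_rotate (N k : ℕ) (L : List Item) :
    listVal N (listRotate k L) = Complex.I ^ k • listVal N L := by
  rw [listRotate, listVal, listVal, List.smul_sum, List.map_map, List.map_map]
  congr 2
  funext u
  simp [itemVal, pow_add, mul_smul]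

/-- Powers of `i` whose sum is `m z i ^ k`. -/
def unitList (m : ℕ) (z : ℤ) (k : ℕ) : List ℕ :=
  -- A negative sign is the factor `i²`.
  (List.range (m * z.natAbs)).map fun _ => if z < 0 then k + 2 else k

theorem sum_unitList (m : ℕ) (z : ℤ) (k : ℕ) :
    ((unitList m z k).map fun p => Complex.I ^ p).sum = m * z * Complex.I ^ k := by
  rw [unitList, List.map_map]
  have : ((fun p => Complex.I ^ p) ∘ fun _ : ℕ => if z < 0 then k + 2 else k) =
      Function.const ℕ (Complex.I ^ (if z < 0 then k + 2 else k)) := rfl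
  rw [this, List.map_const, List.sum_replicate, List.length_range, nsmul_eq_mul]
  split_ifs with h
  · have h' : ((z.natAbs : ℕ) : ℂ) = -(z : ℂ) := by
      have : ((z.natAbs : ℕ) : ℤ) = -z := by omega
      rw [← Int.cast_natCast, this, Int.cast_neg]
    push_cast
    rw [h', pow_add, Complex.I_sq]
    ring
  · have h' : ((z.natAbs : ℕ) : ℂ) = (z : ℂ) := by
      have : ((z.natAbs : ℕ) : ℤ) = z := by omega
      rw [← Int.cast_natCast, this]
    push_cast
    rw [h']

/-- Powers of `i` whose sum is `D` times the coefficient `c`. -/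
def coeffList (D : ℕ) (c : ℤ × ℤ × ℕ) : List ℕ :=
  unitList (D / (c.2.2 + 1)) c.1 0 ++ unitList (D / (c.2.2 + 1)) c.2.1 1

theorem sum_coeffList {D : ℕ} {c : ℤ × ℤ × ℕ} (h : c.2.2 + 1 ∣ D) :
    ((coeffList D c).map fun p => Complex.I ^ p).sum = D * coeffVal c := by
  rw [coeffList, List.map_append, List.sum_append, sum_unitList, sum_unitList,
    Nat.cast_div_charZero h, coeffVal]
  push_cast
  ring

/-! ### The presentation of a UHF algebra by matrix units -/

theorem natUnit_eq_zero {N a b : ℕ} (h : ¬ (a < N ∧ b < N)) : natUnit N a b = 0 := by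
  ext i j
  rw [natUnit_apply, if_neg]
  · rfl
  · rintro ⟨rfl, rfl⟩
    exact h ⟨i.2, j.2⟩

theorem ampHom_natUnit {n N a b : ℕ} (h : n ∣ N) (ha : a < n) (hb : b < n) :
    ampHom (digitEquiv h) (natUnit n a b) =
      ∑ q ∈ Finset.range (N / n), natUnit N (n * q + a) (n * q + b) := by
  ext c d
  obtain ⟨⟨r, i⟩, rfl⟩ := (digitEquiv h).surjective c
  obtain ⟨⟨r', i'⟩, rfl⟩ := (digitEquiv h).surjective d
  rw [ampHom_apply, Matrix.sum_apply]
  simp only [natUnit_apply, digitEquiv_val]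
  have key : ∀ (q r : ℕ) (i : Fin n) (a : ℕ) (_ : a < n), n * r + i = n * q + a ↔
      r = q ∧ (i : ℕ) = a := fun q r i a ha => by
    have := digit_inj (q := r) (r := q) (i := i) (j := ⟨a, ha⟩)
    rwa [Fin.ext_iff] at this
  rw [Finset.sum_eq_single (r : ℕ)]
  · simp only [key _ _ _ _ ha, key _ _ _ _ hb, Fin.ext_iff, true_and, eq_comm (a := (r' : ℕ))]
    by_cases h₁ : (r : ℕ) = r' <;> simp [h₁]
  · intro q _ hq
    simp [key _ _ _ _ ha, Ne.symm hq]
  · intro h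
    exact absurd (Finset.mem_range.2 r.2) h

theorem sum_map_smul {α E : Type*} [AddCommGroup E] [Module ℂ E] (l : List α)
    (f : α → ℂ) (x : E) : (l.map fun a => f a • x).sum = (l.map f).sum • x := by
  induction l with
  | nil => simp
  | cons a l ih => simp [ih, add_smul]

/-- A common denominator of the coefficients. -/
def polyDenom (q : StarPolynomial) : ℕ := (q.map fun m => m.1.2.2 + 1).prod

/-- A bound for the indices of the letters. -/
def polyLevel (q : StarPolynomial) : ℕ :=
  (q.map fun m => ((m.2.1 :: m.2.2).map Prod.fst).sum).sum

theorem polyDenom_pos (q : StarPolynomial) : 0 < polyDenom q := by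
  refine List.prod_pos fun x hx => ?_
  obtain ⟨m, -, rfl⟩ := List.mem_map.1 hx
  exact Nat.succ_pos _

namespace SizeSequence

variable (s : SizeSequence)

/-- The generators of `s.Carrier`: all matrix units of all matrix algebras. -/
noncomputable def gen (j : ℕ) : s.Carrier :=
  s.incl j.unpair.1 (natUnit _ j.unpair.2.unpair.1 j.unpair.2.unpair.2)

/-- A generator as a list of matrix units of the `K`-th matrix algebra. -/
def genList (K j : ℕ) : List Item :=
  if j.unpair.2.unpair.1 < s.size j.unpair.1 ∧ j.unpair.2.unpair.2 < s.size j.unpair.1 then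
    (List.range (s.size K / s.size j.unpair.1)).map fun q =>
      (0, s.size j.unpair.1 * q + j.unpair.2.unpair.1, s.size j.unpair.1 * q + j.unpair.2.unpair.2)
  else []

/-- The level of a generator is at most its index, so a bound for the indices gives a level
containing all generators in use. -/
theorem incl_genList {K j : ℕ} (h : j ≤ K) :
    s.incl K (listVal (s.size K) (s.genList K j)) = s.gen j := by
  have hk : j.unpair.1 ≤ K := (Nat.unpair_left_le j).trans h
  rw [gen, ← s.incl_ampHom hk, genList]
  split_ifs with hab
  · rw [ampHom_natUnit _ hab.1 hab.2, listVal_map_range]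
    simp [itemVal]
  · rw [natUnit_eq_zero hab, map_zero, listVal_nil]

/-- A letter as a list of matrix units. -/
def letterList (K : ℕ) (l : ℕ × Bool) : List Item :=
  if l.2 then listStar (s.genList K l.1) else s.genList K l.1

theorem incl_letterList {K : ℕ} {l : ℕ × Bool} (h : l.1 ≤ K) :
    s.incl K (listVal (s.size K) (s.letterList K l)) = letterVal s.gen l := by
  rw [letterList, letterVal]
  split_ifs
  · rw [listVal_star, map_star, s.incl_genList h]
  · exact s.incl_genList h

/-- A word as a list of matrix units. -/
def wordList (K : ℕ) (w : List (ℕ × Bool)) : List Item :=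
  w.foldr (fun l M => listMul (s.size K) (s.letterList K l) M) (listOne (s.size K))

theorem incl_wordList {K : ℕ} {w : List (ℕ × Bool)} (h : ∀ l ∈ w, l.1 ≤ K) :
    s.incl K (listVal (s.size K) (s.wordList K w)) = (w.map (letterVal s.gen)).prod := by
  induction w with
  | nil => simp [wordList, listVal_one]
  | cons l w ih =>
    rw [List.map_cons, List.prod_cons, ← ih fun l' hl' => h l' (List.mem_cons_of_mem _ hl'),
      ← s.incl_letterList (h l List.mem_cons_self), ← map_mul, ← listVal_mul]
    rfl

/-- `D` times a monomial as a list of signed matrix units. -/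
def monomialList (K D : ℕ) (m : StarMonomial) : List Item :=
  (coeffList D m.1).flatMap fun p => listRotate p (s.wordList K (m.2.1 :: m.2.2))

theorem incl_monomialList {K D : ℕ} {m : StarMonomial} (hD : m.1.2.2 + 1 ∣ D)
    (hK : ∀ l ∈ m.2.1 :: m.2.2, l.1 ≤ K) :
    s.incl K (listVal (s.size K) (s.monomialList K D m)) = (D : ℂ) • monomialVal s.gen m := by
  rw [monomialList, listVal_flatMap]
  simp only [listVal_rotate]
  rw [sum_map_smul, sum_coeffList hD, map_smul, s.incl_wordList hK, monomialVal, mul_smul,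
    List.map_cons, List.prod_cons]

/-- A polynomial, multiplied by its denominator, as a list of signed matrix units. -/
def polyList (q : StarPolynomial) : List Item :=
  q.flatMap (s.monomialList (polyLevel q) (polyDenom q))

theorem incl_polyList (q : StarPolynomial) :
    s.incl (polyLevel q) (listVal (s.size (polyLevel q)) (s.polyList q)) =
      (polyDenom q : ℂ) • rationalPoint s.gen q := by
  rw [polyList, listVal_flatMap, map_list_sum, List.map_map, rationalPoint, List.smul_sum,
    List.map_map]
  congr 1
  refine List.map_congr_left fun m hm => ?_
  refine s.incl_monomialList (List.dvd_prod (List.mem_map.2 ⟨m, hm, rfl⟩)) fun l hl => ?_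
  exact (List.le_sum_of_mem (List.mem_map.2 ⟨l, hl, rfl⟩)).trans
    (List.le_sum_of_mem (List.mem_map.2 ⟨m, hm, rfl⟩))

theorem isPresentation_gen : IsPresentation s.gen := by
  refine s.dense_range.mono (Set.iUnion_subset fun k => ?_)
  rintro _ ⟨x, rfl⟩
  have hx : x = ∑ i, ∑ j, x i j • natUnit (s.size k) i j := by
    conv_lhs => rw [Matrix.matrix_eq_sum_single x]
    refine Finset.sum_congr rfl fun i _ => Finset.sum_congr rfl fun j _ => ?_
    ext a b
    rw [Matrix.smul_apply, natUnit_apply, Matrix.single_apply, smul_eq_mul]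
    simp [Fin.ext_iff, eq_comm]
  rw [hx]
  simp only [map_sum, map_smul]
  refine sum_mem fun i _ => sum_mem fun j _ => SMulMemClass.smul_mem _ ?_
  refine NonUnitalStarAlgebra.subset_adjoin ℂ _ ⟨Nat.pair k (Nat.pair i j), ?_⟩
  -- The matrix type depends on the level, so the levels are identified through a general equation
  -- between variables.
  have h : ∀ {l l' : ℕ}, l = l' → ∀ a b,
      s.incl l (natUnit _ a b) = s.incl l' (natUnit _ a b) := by
    rintro l _ rfl a b
    rfl
  rw [gen, h (l' := k) (by simp)]
  simp

end SizeSequence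
end UHFComp

/-! ### Computability of the norm. -/

namespace UHFComp

/-! ### Primitive recursion on lists of matrix units -/

section Primitive

variable {α : Type*} [Primcodable α]

theorem primrec_pow {f g : α → ℕ} (hf : Primrec f) (hg : Primrec g) :
    Primrec fun a => f a ^ g a :=
  (Primrec₂.unpaired'.1 Nat.Primrec.pow : Primrec₂ fun m n : ℕ => m ^ n).comp hf hg

/-- The code of `n` is `2 n` and that of `-(n + 1)` is `2 n + 1`: halving the successor of the code
gives the absolute value, and parity gives the sign. -/
theorem primrec_natAbs : Primrec Int.natAbs :=
  (Primrec.nat_div.comp (Primrec.succ.comp Primrec.encode) (Primrec.const 2)).of_eq fun z => by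
    rcases z with n | n
    · change (2 * n + 1) / 2 = n
      omega
    · change (2 * n + 1 + 1) / 2 = n + 1
      omega

theorem primrecPred_neg : PrimrecPred fun z : ℤ => z < 0 :=
  PrimrecPred.of_eq (Primrec.eq.comp (Primrec.nat_mod.comp Primrec.encode (Primrec.const 2))
    (Primrec.const 1)) fun z => by
    rcases z with n | n
    · change (2 * n) % 2 = 1 ↔ (Int.ofNat n < 0)
      simp
    · change (2 * n + 1) % 2 = 1 ↔ (Int.negSucc n < 0)
      simp [Int.negSucc_lt_zero, Nat.add_mod]

theorem primrec_intCast : Primrec fun n : ℕ => (n : ℤ) :=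
  Primrec.encode_iff.1 (Primrec.nat_mul.comp (Primrec.const 2) Primrec.id)

theorem primrec_list_sum {f : α → List ℕ} (hf : Primrec f) : Primrec fun a => (f a).sum :=
  Primrec.list_foldr hf (Primrec.const 0)
    (Primrec.nat_add.comp (Primrec.fst.comp Primrec.snd) (Primrec.snd.comp Primrec.snd)).to₂

theorem primrec_list_prod {f : α → List ℕ} (hf : Primrec f) : Primrec fun a => (f a).prod :=
  Primrec.list_foldr hf (Primrec.const 1)
    (Primrec.nat_mul.comp (Primrec.fst.comp Primrec.snd) (Primrec.snd.comp Primrec.snd)).to₂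

theorem primrec_itemMul {N : α → ℕ} {u v : α → Item} (hN : Primrec N) (hu : Primrec u)
    (hv : Primrec v) : Primrec fun a => itemMul (N a) (u a) (v a) := by
  have hv₁ : Primrec fun a => (v a).2.1 := Primrec.fst.comp (Primrec.snd.comp hv)
  refine Primrec.ite (PrimrecPred.and
    (Primrec.eq.comp (Primrec.snd.comp (Primrec.snd.comp hu)) hv₁) (Primrec.nat_lt.comp hv₁ hN))
    (Primrec.list_cons.comp (Primrec.pair (Primrec.nat_add.comp (Primrec.fst.comp hu)
      (Primrec.fst.comp hv)) (Primrec.pair (Primrec.fst.comp (Primrec.snd.comp hu))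
      (Primrec.snd.comp (Primrec.snd.comp hv)))) (Primrec.const [])) (Primrec.const [])

theorem primrec_listMul {N : α → ℕ} {L M : α → List Item} (hN : Primrec N) (hL : Primrec L)
    (hM : Primrec M) : Primrec fun a => listMul (N a) (L a) (M a) := by
  have h : Primrec₂ fun (x : α × Item) (v : Item) => itemMul (N x.1) x.2 v :=
    (primrec_itemMul (hN.comp (Primrec.fst.comp Primrec.fst))
      (Primrec.snd.comp Primrec.fst) Primrec.snd).to₂
  exact Primrec.list_flatMap hL (Primrec.list_flatMap (hM.comp Primrec.fst) h).to₂

theorem primrec_listStar {L : α → List Item} (hL : Primrec L) :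
    Primrec fun a => listStar (L a) := by
  refine Primrec.list_map hL (Primrec.pair (Primrec.nat_mul.comp (Primrec.const 3)
    (Primrec.fst.comp Primrec.snd)) (Primrec.pair (Primrec.snd.comp (Primrec.snd.comp Primrec.snd))
    (Primrec.fst.comp (Primrec.snd.comp Primrec.snd)))).to₂

theorem primrec_diagCount (r : ℕ) : Primrec₂ fun N (L : List Item) => diagCount r N L := by
  have hR : PrimrecRel fun (u : Item) (N : ℕ) =>
      u.1 % 4 = r ∧ u.2.1 = u.2.2 ∧ u.2.2 < N :=
    PrimrecPred.and (Primrec.eq.comp (Primrec.nat_mod.comp (Primrec.fst.comp Primrec.fst)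
      (Primrec.const 4)) (Primrec.const r)) (PrimrecPred.and (Primrec.eq.comp
      (Primrec.fst.comp (Primrec.snd.comp Primrec.fst))
      (Primrec.snd.comp (Primrec.snd.comp Primrec.fst)))
      (Primrec.nat_lt.comp (Primrec.snd.comp (Primrec.snd.comp Primrec.fst)) Primrec.snd))
  exact Primrec.list_length.comp (hR.listFilter.comp Primrec.snd Primrec.fst)

theorem primrec_starSquareList {N j : α → ℕ} {L : α → List Item} (hN : Primrec N)
    (hL : Primrec L) (hj : Primrec j) : Primrec fun a => starSquareList (N a) (L a) (j a) := by
  have hstep : Primrec₂ fun (a : α) (p : ℕ × List Item) => listMul (N a) (listStar p.2) p.2 :=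
    (primrec_listMul (hN.comp Primrec.fst) (primrec_listStar (Primrec.snd.comp Primrec.snd))
      (Primrec.snd.comp Primrec.snd)).to₂
  refine (Primrec.nat_rec' hj hL hstep).of_eq fun a => ?_
  induction j a with
  | zero => rfl
  | succ j ih => rw [starSquareList, ← ih]

theorem primrec_listOne {N : α → ℕ} (hN : Primrec N) : Primrec fun a => listOne (N a) :=
  Primrec.list_map (Primrec.list_range.comp hN)
    (Primrec.pair (Primrec.const 0) (Primrec.pair Primrec.snd Primrec.snd)).to₂

theorem primrec_unitList {m : α → ℕ} {z : α → ℤ} (k : ℕ) (hm : Primrec m) (hz : Primrec z) :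
    Primrec fun a => unitList (m a) (z a) k :=
  Primrec.list_map (Primrec.list_range.comp (Primrec.nat_mul.comp hm (primrec_natAbs.comp hz)))
    (Primrec.ite (primrecPred_neg.comp (hz.comp Primrec.fst)) (Primrec.const (k + 2))
      (Primrec.const k)).to₂

theorem primrec_coeffList {D : α → ℕ} {c : α → ℤ × ℤ × ℕ} (hD : Primrec D) (hc : Primrec c) :
    Primrec fun a => coeffList (D a) (c a) := by
  have hm : Primrec fun a => D a / ((c a).2.2 + 1) :=
    Primrec.nat_div.comp hD (Primrec.succ.comp (Primrec.snd.comp (Primrec.snd.comp hc)))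
  exact Primrec.list_append.comp (primrec_unitList 0 hm (Primrec.fst.comp hc))
    (primrec_unitList 1 hm (Primrec.fst.comp (Primrec.snd.comp hc)))

theorem primrec_polyDenom : Primrec polyDenom :=
  primrec_list_prod (Primrec.list_map Primrec.id (Primrec.succ.comp
    (Primrec.snd.comp (Primrec.snd.comp (Primrec.fst.comp Primrec.snd)))).to₂)

theorem primrec_word : Primrec fun m : StarMonomial => m.2.1 :: m.2.2 :=
  Primrec.list_cons.comp (Primrec.fst.comp Primrec.snd) (Primrec.snd.comp Primrec.snd)

theorem primrec_polyLevel : Primrec polyLevel :=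
  primrec_list_sum (Primrec.list_map Primrec.id (primrec_list_sum (Primrec.list_map
    (primrec_word.comp Primrec.snd) (Primrec.fst.comp Primrec.snd).to₂)).to₂)

/-- The norm certificate in terms of natural numbers. -/
def NatCertificate (n D G pos neg m j : ℕ) : Prop :=
  n * (m * D) ^ 2 ^ (j + 1) + neg * G ^ 2 ^ (j + 1) ≤ pos * G ^ 2 ^ (j + 1) ∧
    n ^ 2 * (pos * G ^ 2 ^ (j + 1)) ≤
      ((m + 2) * D) ^ 2 ^ (j + 1) + n ^ 2 * (neg * G ^ 2 ^ (j + 1))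

/-- The negative count is moved across each inequality, so that only natural numbers are compared
and the test is primitive recursive. -/
theorem natCertificate_iff {n D G pos neg m j : ℕ} {t : ℕ → ℝ}
    (ht : t j = (pos : ℝ) - neg) :
    NatCertificate n D G pos neg m j ↔ NormCertificate n D G t m j := by
  rw [NatCertificate, NormCertificate, ht]
  refine and_congr ?_ ?_
  · rw [← Nat.cast_le (α := ℝ)]
    push_cast
    rw [sub_mul, le_sub_iff_add_le]
  · rw [← Nat.cast_le (α := ℝ)]
    push_cast
    rw [sub_mul, mul_sub, sub_le_iff_le_add]

theorem primrecPred_natCertificate {n D G pos neg m j : α → ℕ} (hn : Primrec n)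
    (hD : Primrec D) (hG : Primrec G) (hpos : Primrec pos) (hneg : Primrec neg) (hm : Primrec m)
    (hj : Primrec j) :
    PrimrecPred fun a => NatCertificate (n a) (D a) (G a) (pos a) (neg a) (m a) (j a) := by
  have hE : Primrec fun a => 2 ^ (j a + 1) := primrec_pow (Primrec.const 2) (Primrec.succ.comp hj)
  have hGE := primrec_pow hG hE
  have hn2 : Primrec fun a => n a ^ 2 := primrec_pow hn (Primrec.const 2)
  exact PrimrecPred.and
    (Primrec.nat_le.comp (Primrec.nat_add.comp
      (Primrec.nat_mul.comp hn (primrec_pow (Primrec.nat_mul.comp hm hD) hE))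
      (Primrec.nat_mul.comp hneg hGE)) (Primrec.nat_mul.comp hpos hGE))
    (Primrec.nat_le.comp (Primrec.nat_mul.comp hn2 (Primrec.nat_mul.comp hpos hGE))
      (Primrec.nat_add.comp (primrec_pow (Primrec.nat_mul.comp
        (Primrec.nat_add.comp hm (Primrec.const 2)) hD) hE)
        (Primrec.nat_mul.comp hn2 (Primrec.nat_mul.comp hneg hGE))))

end Primitive

namespace SizeSequence

variable {s : SizeSequence}

theorem primrec_genList (hs : Primrec s.size) : Primrec₂ s.genList := by
  have hj : Primrec fun p : ℕ × ℕ => p.2.unpair := Primrec.unpair.comp Primrec.snd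
  have hn : Primrec fun p : ℕ × ℕ => s.size p.2.unpair.1 := hs.comp (Primrec.fst.comp hj)
  have hab : Primrec fun p : ℕ × ℕ => p.2.unpair.2.unpair :=
    Primrec.unpair.comp (Primrec.snd.comp hj)
  have ha := Primrec.fst.comp hab
  have hb := Primrec.snd.comp hab
  have hshift : ∀ {c : ℕ × ℕ → ℕ}, Primrec c →
      Primrec fun x : (ℕ × ℕ) × ℕ => s.size x.1.2.unpair.1 * x.2 + c x.1 := fun hc =>
    Primrec.nat_add.comp (Primrec.nat_mul.comp (hn.comp Primrec.fst) Primrec.snd)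
      (hc.comp Primrec.fst)
  exact Primrec.ite (PrimrecPred.and (Primrec.nat_lt.comp ha hn) (Primrec.nat_lt.comp hb hn))
    (Primrec.list_map (Primrec.list_range.comp (Primrec.nat_div.comp (hs.comp Primrec.fst) hn))
      (Primrec.pair (Primrec.const 0) (Primrec.pair (hshift ha) (hshift hb))).to₂)
    (Primrec.const [])

theorem primrec_letterList (hs : Primrec s.size) : Primrec₂ s.letterList := by
  have h : Primrec fun p : ℕ × ℕ × Bool => s.genList p.1 p.2.1 :=
    (primrec_genList hs).comp Primrec.fst (Primrec.fst.comp Primrec.snd)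
  exact Primrec.ite (Primrec.eq.comp (Primrec.snd.comp Primrec.snd) (Primrec.const true))
    (primrec_listStar h) h

theorem primrec_wordList (hs : Primrec s.size) : Primrec₂ s.wordList := by
  have hK : Primrec fun x : (ℕ × List (ℕ × Bool)) × (ℕ × Bool) × List Item => x.1.1 :=
    Primrec.fst.comp Primrec.fst
  exact Primrec.list_foldr Primrec.snd (primrec_listOne (hs.comp Primrec.fst))
    (primrec_listMul (hs.comp hK)
      ((primrec_letterList hs).comp hK (Primrec.fst.comp Primrec.snd))
      (Primrec.snd.comp Primrec.snd)).to₂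

theorem primrec_polyList (hs : Primrec s.size) : Primrec s.polyList := by
  have hrot : Primrec fun x : (StarPolynomial × StarMonomial) × ℕ =>
      listRotate x.2 (s.wordList (polyLevel x.1.1) (x.1.2.2.1 :: x.1.2.2.2)) := by
    refine Primrec.list_map ((primrec_wordList hs).comp
      (primrec_polyLevel.comp (Primrec.fst.comp Primrec.fst))
      (primrec_word.comp (Primrec.snd.comp Primrec.fst))) ?_
    exact (Primrec.pair (Primrec.nat_add.comp (Primrec.snd.comp Primrec.fst)
      (Primrec.fst.comp Primrec.snd)) (Primrec.snd.comp Primrec.snd)).to₂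
  exact Primrec.list_flatMap Primrec.id (Primrec.list_flatMap
    (primrec_coeffList (primrec_polyDenom.comp Primrec.fst) (Primrec.fst.comp Primrec.snd))
    hrot.to₂).to₂

/-! ### Computability of the norm -/

/-- The number `p` codes a pair `(m, j)` that certifies that the norm of `q` is close to
`m / 2 ^ (k + 2)`. -/
def Certifies (s : SizeSequence) (x : StarPolynomial × ℕ) (p : ℕ) : Prop :=
  NatCertificate (s.size (polyLevel x.1)) (polyDenom x.1) (2 ^ (x.2 + 2))
    (diagCount 0 (s.size (polyLevel x.1))
      (starSquareList (s.size (polyLevel x.1)) (s.polyList x.1) (p.unpair.2 + 1)))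
    (diagCount 2 (s.size (polyLevel x.1))
      (starSquareList (s.size (polyLevel x.1)) (s.polyList x.1) (p.unpair.2 + 1)))
    p.unpair.1 p.unpair.2

theorem primrecRel_certifies (hs : Primrec s.size) : PrimrecRel (Certifies s) := by
  have hq : Primrec fun y : (StarPolynomial × ℕ) × ℕ => y.1.1 := Primrec.fst.comp Primrec.fst
  have hn : Primrec fun y : (StarPolynomial × ℕ) × ℕ => s.size (polyLevel y.1.1) :=
    hs.comp (primrec_polyLevel.comp hq)
  have hp : Primrec fun y : (StarPolynomial × ℕ) × ℕ => y.2.unpair :=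
    Primrec.unpair.comp Primrec.snd
  have hj := Primrec.snd.comp hp
  have hY : Primrec fun y : (StarPolynomial × ℕ) × ℕ =>
      starSquareList (s.size (polyLevel y.1.1)) (s.polyList y.1.1) (y.2.unpair.2 + 1) :=
    primrec_starSquareList hn ((primrec_polyList hs).comp hq) (Primrec.succ.comp hj)
  exact primrecPred_natCertificate hn (primrec_polyDenom.comp hq)
    (primrec_pow (Primrec.const 2) (Primrec.nat_add.comp (Primrec.snd.comp Primrec.fst)
      (Primrec.const 2)))
    ((primrec_diagCount 0).comp hn hY) ((primrec_diagCount 2).comp hn hY)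
    (Primrec.fst.comp hp) hj

section
open scoped Matrix.Norms.L2Operator

theorem norm_polyList (q : StarPolynomial) :
    ‖listVal (s.size (polyLevel q)) (s.polyList q)‖ = polyDenom q * ‖rationalPoint s.gen q‖ := by
  refine (s.limit.norm_incl (polyLevel q)
    (listVal (s.size (polyLevel q)) (s.polyList q))).symm.trans ?_
  change ‖s.incl _ _‖ = _
  rw [s.incl_polyList, norm_smul, Complex.norm_natCast]

theorem certifies_iff {x : StarPolynomial × ℕ} {p : ℕ} :
    Certifies s x p ↔ NormCertificate (s.size (polyLevel x.1)) (polyDenom x.1) (2 ^ (x.2 + 2))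
      (fun j => (starSquare (listVal (s.size (polyLevel x.1)) (s.polyList x.1))
        (j + 1)).trace.re) p.unpair.1 p.unpair.2 := by
  refine natCertificate_iff ?_
  rw [← listVal_starSquareList, re_trace_listVal]

theorem exists_certifies (x : StarPolynomial × ℕ) : ∃ p, Certifies s x p := by
  obtain ⟨m, j, h⟩ := NormCertificate.exists (s.size_pos (polyLevel x.1)) (polyDenom_pos x.1)
    (G := 2 ^ (x.2 + 2)) (by positivity) (norm_nonneg (rationalPoint s.gen x.1))
    (fun j => by rw [← norm_polyList]; exact le_trace_starSquare _ j)
    (fun j => by rw [← norm_polyList]; exact trace_starSquare_le _ j)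
  exact ⟨Nat.pair m j, certifies_iff.2 (by simpa using h)⟩

theorem Certifies.bounds {x : StarPolynomial × ℕ} {p : ℕ} (h : Certifies s x p) :
    |‖rationalPoint s.gen x.1‖ - (p.unpair.1 : ℝ) / (2 ^ (x.2 + 2) : ℕ)| ≤
      2 / (2 ^ (x.2 + 2) : ℕ) :=
  NormCertificate.bounds (s.size_pos (polyLevel x.1)) (polyDenom_pos x.1) (by positivity)
    (norm_nonneg _) (fun j => by rw [← norm_polyList]; exact le_trace_starSquare _ j)
    (fun j => by rw [← norm_polyList]; exact trace_starSquare_le _ j) (certifies_iff.1 h)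

end

/-- The UHF algebra of a primitive recursive sequence of matrix sizes has a computable
presentation. -/
theorem computablyPresentable (hs : Primrec s.size) : ComputablyPresentable s.Carrier := by
  refine ⟨s.gen, s.isPresentation_gen, ?_⟩
  obtain ⟨f, hf, hspec⟩ := exists_computable_choice (primrecRel_certifies hs) exists_certifies
  -- The output format adds 1 to the stored denominator. With denominator `2 ^ (k + 2)` the error is
  -- at most `2 / 2 ^ (k + 2)`, half the permitted bound.
  refine ⟨fun q k => (((f (q, k)).unpair.1 : ℤ), 2 ^ (k + 2) - 1), ?_, fun q k => ?_⟩
  · have h₁ : Computable fun x : StarPolynomial × ℕ => ((f x).unpair.1 : ℤ) :=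
      (primrec_intCast.comp (Primrec.fst.comp Primrec.unpair)).to_comp.comp hf
    have h₂ : Primrec fun x : StarPolynomial × ℕ => 2 ^ (x.2 + 2) - 1 :=
      Primrec.nat_sub.comp (primrec_pow (Primrec.const 2)
        (Primrec.nat_add.comp Primrec.snd (Primrec.const 2))) (Primrec.const 1)
    exact (h₁.pair h₂.to_comp).to₂
  · have h := (hspec (q, k)).bounds
    have hden : (((2 ^ (k + 2) - 1 : ℕ) : ℝ) + 1) = (2 ^ (k + 2) : ℕ) := by
      rw [← Nat.cast_add_one, Nat.sub_add_cancel Nat.one_le_two_pow]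
    simp only [hden, Int.cast_natCast]
    refine h.trans_lt ?_
    push_cast
    rw [inv_pow, div_lt_iff₀ (by positivity), pow_add, ← mul_assoc,
      inv_mul_cancel₀ (by positivity)]
    norm_num

end SizeSequence
end UHFComp

/-! ### The algebra realizing `p_e ↦ |W_e|`. -/

namespace UHFComp

/-! ### The UHF algebra with supernatural number `|W_e|` -/

/-- The contribution of `p` to the `k`-th matrix size. -/
def primeFactor (k p : ℕ) : ℕ := if p.Prime then p ^ stageApprox k p else 1

/-- The sequence of matrix sizes `∏_{p < k} p ^ stageApprox k p`. -/
def cardSizes : SizeSequence where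
  size k := ((List.range k).map (primeFactor k)).prod
  size_pos k := by
    refine List.prod_pos fun x hx => ?_
    obtain ⟨p, -, rfl⟩ := List.mem_map.1 hx
    rw [primeFactor]
    split_ifs with h
    · exact pow_pos h.pos _
    · exact one_pos
  size_dvd k := by
    change (∏ p ∈ Finset.range k, primeFactor k p) ∣
      ∏ p ∈ Finset.range (k + 1), primeFactor (k + 1) p
    refine (Finset.prod_dvd_prod_of_dvd _ _ fun p _ => ?_).trans
      (Finset.prod_dvd_prod_of_subset _ _ _ (Finset.range_mono (Nat.le_succ k)))
    rw [primeFactor, primeFactor]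
    split_ifs
    · exact pow_dvd_pow _ (stageApprox_mono (Nat.le_succ k) p)
    · exact dvd_rfl

theorem cardSizes_size (k : ℕ) :
    cardSizes.size k = ∏ p ∈ Finset.range k, primeFactor k p := rfl

theorem primrec_cardSizes : Primrec cardSizes.size := by
  have h : Primrec₂ primeFactor :=
    Primrec.ite (primrecPred_prime.comp Primrec.snd)
      (primrec_pow Primrec.snd primrec_stageApprox) (Primrec.const 1)
  exact primrec_list_prod (Primrec.list_map Primrec.list_range h)

/-- All factors belonging to other primes are coprime to `p`. -/
theorem le_of_pow_dvd_cardSizes {p m k : ℕ} (hp : p.Prime) (h : p ^ m ∣ cardSizes.size k) :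
    m ≤ stageApprox k p := by
  have hc : Nat.Coprime (p ^ m) (∏ r ∈ (Finset.range k).erase p, primeFactor k r) := by
    refine Nat.Coprime.pow_left _ (Nat.Coprime.prod_right fun r hr => ?_)
    rw [primeFactor]
    split_ifs with hr'
    · exact Nat.Coprime.pow_right _
        ((Nat.coprime_primes hp hr').2 (Finset.ne_of_mem_erase hr).symm)
    · exact Nat.coprime_one_right p
  have hdvd : cardSizes.size k ∣
      p ^ stageApprox k p * ∏ r ∈ (Finset.range k).erase p, primeFactor k r := by
    rw [cardSizes_size]
    by_cases hk : p ∈ Finset.range k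
    · rw [← Finset.mul_prod_erase _ _ hk, primeFactor, if_pos hp]
    · rw [Finset.erase_eq_of_notMem hk]
      exact dvd_mul_left _ _
  exact (Nat.pow_dvd_pow_iff_le_right hp.one_lt).1 (hc.dvd_of_dvd_mul_right (h.trans hdvd))

/-- The prime `p` contributes only at levels above `p`, hence the maximum with `p + 1`; passing to a
later stage can only raise the exponent. -/
theorem pow_dvd_cardSizes {p : ℕ} (hp : p.Prime) (k : ℕ) :
    p ^ stageApprox k p ∣ cardSizes.size (max k (p + 1)) := by
  refine (pow_dvd_pow p (stageApprox_mono (le_max_left k (p + 1)) p)).trans ?_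
  have h := Finset.dvd_prod_of_mem (primeFactor (max k (p + 1)))
    (Finset.mem_range.2 (lt_max_of_lt_right (Nat.lt_succ_self p)) :
      p ∈ Finset.range (max k (p + 1)))
  rwa [primeFactor, if_pos hp] at h

theorem supernatural_cardSizes : cardSizes.limit.supernatural = cardSupernatural := by
  funext p
  rw [cardSupernatural, ← iSup_stageCard]
  refine le_antisymm (iSup₂_le ?_) (iSup_le fun j => ?_)
  · rintro m ⟨k, hk⟩
    exact le_iSup_of_le (f := fun j => (stageCard j (Nat.count Nat.Prime p) : ℕ∞)) k
      (Nat.cast_le.2 (le_of_pow_dvd_cardSizes p.2 hk))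
  · exact le_iSup₂_of_le (f := fun (m : ℕ) _ => (m : ℕ∞)) (stageApprox j p)
      ⟨_, pow_dvd_cardSizes p.2 j⟩ le_rfl

end UHFComp

/-- There is a lower semicomputable supernatural number `ε`, given by `ε(p_e) = |W_e|`, of Turing
degree `0''`; it is the noncomputable supernatural number of a computably presentable UHF
algebra. -/
theorem mainTheorem7 :
    ∃ ε : UHFComp.Supernatural,
      (∀ e : ℕ, ε (UHFComp.nthPrime e) = (UHFComp.W e).encard) ∧
      UHFComp.LowerSemicomputable ε ∧
      UHFComp.turingDegree ε = UHFComp.zeroDoubleJump ∧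
      ∃ (A : Type) (_ : CStarAlgebra A),
        UHFComp.IsUHF A ∧ UHFComp.ComputablyPresentable A ∧
        UHFComp.IsSupernaturalNumberOf ε A ∧ ¬ Computable ε :=
  ⟨UHFComp.cardSupernatural, UHFComp.cardSupernatural_nthPrime,
    UHFComp.lowerSemicomputable_cardSupernatural, UHFComp.turingDegree_cardSupernatural,
    UHFComp.cardSizes.Carrier, inferInstance, ⟨UHFComp.cardSizes.limit⟩,
    UHFComp.SizeSequence.computablyPresentable UHFComp.primrec_cardSizes,
    UHFComp.cardSizes.isSupernaturalNumberOf UHFComp.supernatural_cardSizes,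
    UHFComp.not_computable_cardSupernatural⟩
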